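/- An oriented virtual knot is an equivalence class of oriented virtual knot diagrams modulo the generalized Reidemeister moves; equivalently, an equivalence class of Gauss diagrams modulo the three Reidemeister moves. For a diagram $D$ let $C(D)$ be its set of classical crossings. Label the arcs of $D$ by integers so that, with the two strands at a classical crossing drawn upwards, the label changes from $a$ to $a-1$ along the strand from the lower left to the upper right and from $b$ to $b+1$ along the strand from the lower right to the upper left (labels do not change at virtual crossings), and put $\operatorname{Ind}(c)=\operatorname{sgn}(c)(a-b-1)$ for $c\in C(D)$. For $n\in\mathbb Z$ let $J_n(D)=\sum_{\operatorname{Ind}(c)=n}\operatorname{sgn}(c)$ and $\nabla J_n(D)=J_n(D)-J_{-n}(D)$. Let $D_c$ be the knot diagram obtained from $D$ by smoothing the classical crossing $c$ against the orientation. Here one of the two halves into which $c$ divides the knot is reversed; one of the following two conventions is fixed for all crossings: the path from the overpass to the underpass of $c$ keeps its orientation, or the path from the underpass to the overpass does. All claims below hold for either convention. For $n,m\in\mathbb Z$ let $$\nabla J_{n,m}(D)=\sum_{\operatorname{Ind}(c)=m}\operatorname{sgn}(c)\operatorname{Ind}(c)\,\nabla J_n(D_c)-\sum_{\operatorname{Ind}(c)=-m}\operatorname{sgn}(c)\operatorname{Ind}(c)\,\nabla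 J_n(D_c)$$ be the $(n,m)$-difference writhe. For an integer-valued function $s$ of classical crossings and a virtual knot $L$, let $R(s,L)$ be the set of values of $s$ at those classical crossings, in any diagram of $L$, that can be removed by a single first Reidemeister move. For a diagram $D$ of $L$ let $$F^{n,m,k}_D(t,\ell_1,\ell_2)=\sum_{c\in C(D)}\operatorname{sgn}(c)\,t^{\operatorname{Ind}(c)}\ell_1^{\nabla J_n(D_c)}\ell_2^{\nabla J_{m,k}(D_c)}-\sum_{c\in T(D)}\operatorname{sgn}(c)\,\ell_1^{\nabla J_n(D_c)}\ell_2^{\nabla J_{m,k}(D_c)}-\sum_{c\in C(D)\setminus T(D)}\operatorname{sgn}(c)\,\ell_1^{\nabla J_n(D)}\ell_2^{\nabla J_{m,k}(D)},$$ where $T(D)$ is the set of all $c\in C(D)$ such that $\nabla J_n(D_c)\in R(s_1,L)$ and $\nabla J_{m,k}(D_c)\in R(s_2,L)$, for the functions $s_1(c)=\nabla J_n(D_c)$ and $s_2(c)=\nabla J_{m,k}(D_c)$. The $F$-polynomials are $$F^n_D(t,\ell)=\sum_{c\in C(D)}\operatorname{sgn}(c)\,t^{\operatorname{Ind}(c)}\ell^{\nabla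 J_n(D_c)}-\sum_{c\in T_n(D)}\operatorname{sgn}(c)\,\ell^{\nabla J_n(D_c)}-\sum_{c\in C(D)\setminus T_n(D)}\operatorname{sgn}(c)\,\ell^{\nabla J_n(D)},\qquad T_n(D)=\{c\in C(D) : \nabla J_n(D_c)=\pm\nabla J_n(D)\}.$$ **Theorem.** (i) For all $n,m,k\in\mathbb Z$, $F^{n,m,k}$ is an oriented virtual knot invariant: equivalent diagrams have the same polynomial. (ii) The family $F^{n,m,k}$ is strictly stronger than the family $F^n$. In detail: (a) for every diagram $D$ there is $k_0$ such that $F^{n,m,k}_D(t,\ell_1,\ell_2)=F^n_D(t,\ell_1)$ for all $n,m$ and all $k\ge k_0$; hence, if $F^{n,m,k}_D=F^{n,m,k}_{D'}$ for all $n,m,k$, then $F^n_D=F^n_{D'}$ for all $n$; (b) there is a virtual knot $K'$ with $F^n_{K'}=0$ for all $n$ and $F^{1,1,1}_{K'}=2-\ell_2^{4}-\ell_2^{-4}$; (c) there is such an example with only five classical crossings $\alpha,\beta,\gamma,\delta_1,\delta_2$, where $\operatorname{sgn}(\alpha)=\operatorname{sgn}(\gamma)=1$, $\operatorname{sgn}(\beta)=\operatorname{sgn}(\delta_1)=\operatorname{sgn}(\delta_2)=-1$,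 $\operatorname{Ind}(\alpha)=\operatorname{Ind}(\beta)=1$, $\operatorname{Ind}(\gamma)=\operatorname{Ind}(\delta_1)=\operatorname{Ind}(\delta_2)=0$: all $F^n$ vanish, and $F^{1,1,1}=2-2\ell_2^{-4}$. -/

import Mathlib

open AddMonoidAlgebra

/-!
# Oriented virtual knots as Gauss diagrams

An oriented virtual knot diagram is recorded by its Gauss diagram, written as a cyclic word: travel
once around the knot in the direction of its orientation and write down every passage through a
classical crossing, with the name of the crossing, whether the passage is over or under, and the
sign of the crossing. Virtual crossings are not recorded. Every such word comes from a virtual knot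
diagram, and two virtual knot diagrams have the same Gauss diagram if and only if they are related
by the virtual and the semivirtual Reidemeister moves; so virtual knots are Gauss diagrams
up to the three classical Reidemeister moves.
-/

namespace VirtualKnot

/-- A passage of the knot through a classical crossing. -/
@[ext] structure Passage where
  /-- the name of the crossing -/
  crossing : ℕ
  /-- `true` for the overpass, `false` for the underpass -/
  isOver : Bool
  /-- the sign of the crossing -/
  sign : ℤˣ

/-- A (based, labelled) Gauss diagram of an oriented virtual knot: every crossing that occurs has
exactly one overpass and exactly one underpass, and they carry the same sign. -/
structure Diagram where
  /-- the passages, in the order in which the knot runs through them -/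
  word : List Passage
  nodup : (word.map fun p => (p.crossing, p.isOver)).Nodup
  paired : ∀ p ∈ word, (⟨p.crossing, !p.isOver, p.sign⟩ : Passage) ∈ word

/-- The two passages `p`, `q`, in this order if `ε = 1` and in the opposite order if `ε = -1`. -/
def inOrder (ε : ℤˣ) (p q : Passage) : List Passage :=
  if ε = 1 then [p, q] else [q, p]

/-- The moves between Gauss words. The base point and the names of the crossings do not matter
(`rotate`, `relabel`); the other constructors are the Reidemeister moves, with all orientations of
the strands. Since words may be rotated, one of the strands involved may be put in front.

In the third move there are a top, a middle and a bottom strand, with crossings `a` (top over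
middle), `b` (top over bottom) and `c` (middle over bottom). For three straight lines forming a
triangle, whose crossing signs are `sa`, `sb`, `sc` (the sign of the determinant of the directions
of the upper and the lower line), there is `ε = ±1` such that the top line meets `a` before `b` iff
`ε * sa * sb = 1`, the middle line meets `a` before `c` iff `ε * sa * sc = 1`, and the bottom line
meets `b` before `c` iff `ε * sb * sc = 1`. The move changes `ε` to `-ε`. -/
inductive Move : List Passage → List Passage → Prop
  | rotate (w w' : List Passage) (h : w ~r w') : Move w w'
  | relabel (f : ℕ → ℕ) (hf : Function.Injective f) (w : List Passage) :
      Move w (w.map fun p => ⟨f p.crossing, p.isOver, p.sign⟩)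
  | reidemeister1 (a : ℕ) (o : Bool) (s : ℤˣ) (w : List Passage) :
      Move (⟨a, o, s⟩ :: ⟨a, !o, s⟩ :: w) w
  | reidemeister2_direct (a b : ℕ) (s : ℤˣ) (x y : List Passage) :
      Move ([⟨a, true, s⟩, ⟨b, true, -s⟩] ++ x ++ [⟨a, false, s⟩, ⟨b, false, -s⟩] ++ y) (x ++ y)
  | reidemeister2_reverse (a b : ℕ) (s : ℤˣ) (x y : List Passage) :
      Move ([⟨a, true, s⟩, ⟨b, true, -s⟩] ++ x ++ [⟨b, false, -s⟩, ⟨a, false, s⟩] ++ y) (x ++ y)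
  | reidemeister3_tmb (a b c : ℕ) (sa sb sc ε : ℤˣ) (x y z : List Passage) :
      Move
        (inOrder (ε * sa * sb) ⟨a, true, sa⟩ ⟨b, true, sb⟩ ++ x ++
          inOrder (ε * sa * sc) ⟨a, false, sa⟩ ⟨c, true, sc⟩ ++ y ++
          inOrder (ε * sb * sc) ⟨b, false, sb⟩ ⟨c, false, sc⟩ ++ z)
        (inOrder (-ε * sa * sb) ⟨a, true, sa⟩ ⟨b, true, sb⟩ ++ x ++
          inOrder (-ε * sa * sc) ⟨a, false, sa⟩ ⟨c, true, sc⟩ ++ y ++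
          inOrder (-ε * sb * sc) ⟨b, false, sb⟩ ⟨c, false, sc⟩ ++ z)
  | reidemeister3_tbm (a b c : ℕ) (sa sb sc ε : ℤˣ) (x y z : List Passage) :
      Move
        (inOrder (ε * sa * sb) ⟨a, true, sa⟩ ⟨b, true, sb⟩ ++ x ++
          inOrder (ε * sb * sc) ⟨b, false, sb⟩ ⟨c, false, sc⟩ ++ y ++
          inOrder (ε * sa * sc) ⟨a, false, sa⟩ ⟨c, true, sc⟩ ++ z)
        (inOrder (-ε * sa * sb) ⟨a, true, sa⟩ ⟨b, true, sb⟩ ++ x ++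
          inOrder (-ε * sb * sc) ⟨b, false, sb⟩ ⟨c, false, sc⟩ ++ y ++
          inOrder (-ε * sa * sc) ⟨a, false, sa⟩ ⟨c, true, sc⟩ ++ z)

/-- Two diagrams present the same oriented virtual knot: they are joined by a finite sequence of
moves between diagrams and their inverses. -/
def Equivalent : Diagram → Diagram → Prop :=
  Relation.EqvGen fun D D' => Move D.word D'.word

/-! ## Sign, index, writhes -/

/-- The set `C(D)` of classical crossings. -/
def crossings (w : List Passage) : Finset ℕ := (w.map Passage.crossing).toFinset

/-- The sign of a crossing (`0` if there is no such crossing). -/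
def sgn (w : List Passage) (c : ℕ) : ℤ :=
  ((w.find? fun p => p.crossing = c).map fun p => (p.sign : ℤ)).getD 0

/-- The change of the arc label at a passage. With both strands at a crossing drawn upwards, the
label decreases by one along the strand that runs from the lower left to the upper right (this is
the overpass of a positive and the underpass of a negative crossing) and increases by one along the
other strand. -/
def Passage.labelStep (p : Passage) : ℤ := if p.isOver then -(p.sign : ℤ) else p.sign

/-- The label of the arc that enters the overpass (`o = true`) or the underpass (`o = false`) of the
crossing `c`, where the first arc of the word has label `0`. (The labelling is unique up to an
additive constant.) -/
def labelIn (w : List Passage) (c : ℕ) (o : Bool) : ℤ :=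
  ((w.takeWhile fun p => !(p.crossing = c ∧ p.isOver = o)).map Passage.labelStep).sum

/-- The index `Ind(c) = sgn(c) (a - b - 1)`, where `a` is the label of the arc entering the crossing
`c` from the lower left and `b` that of the arc entering from the lower right. -/
def ind (w : List Passage) (c : ℕ) : ℤ :=
  let a := labelIn w c (sgn w c = 1)
  let b := labelIn w c (!(sgn w c = 1))
  sgn w c * (a - b - 1)

/-- The `n`-th writhe `J_n(D)`. -/
def writhe (n : ℤ) (w : List Passage) : ℤ :=
  ∑ c ∈ crossings w with ind w c = n, sgn w c

/-- The `n`-th difference writhe `∇J_n(D) = J_n(D) - J_{-n}(D)`. -/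
def dwrithe (n : ℤ) (w : List Passage) : ℤ := writhe n w - writhe (-n) w

/-! ## Type-1 smoothing (smoothing against orientation) -/

/-- The word, read from just behind the overpass of `c`: it is `x ++ [underpass of c] ++ y`, where
`x` is the path from the overpass to the underpass of `c` and `y` the path back. -/
def fromOverpass (w : List Passage) (c : ℕ) : List Passage :=
  (w.rotate (w.findIdx fun p => p.crossing = c ∧ p.isOver = true)).tail

/-- The path `x` from the overpass of `c` to its underpass. -/
def overToUnder (w : List Passage) (c : ℕ) : List Passage :=
  (fromOverpass w c).takeWhile fun p => !(p.crossing = c)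

/-- The path `y` from the underpass of `c` to its overpass. -/
def underToOver (w : List Passage) (c : ℕ) : List Passage :=
  ((fromOverpass w c).dropWhile fun p => !(p.crossing = c)).tail

/-- Join two paths to one closed curve, the second one run through backwards. The sign of a crossing
changes if exactly one of its two passages is reversed. -/
def joinReversed (x y : List Passage) : List Passage :=
  (x ++ y.reverse).map fun p =>
    if (x.any fun q => q.crossing = p.crossing) && (y.any fun q => q.crossing = p.crossing)
    then ⟨p.crossing, p.isOver, -p.sign⟩ else p

/-- The diagram `D_c` obtained from `D` by type-1 smoothing at `c`. Smoothing against the orientation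
makes it necessary to reverse one of the two halves of the knot. There are two conventions (which half
it is has to depend on which strand is the upper one, so that a crossing change at `c` reverses `D_c`): `κ = true`
keeps the orientation of the path from the overpass to the underpass of `c` and reverses the
other half, `κ = false` does the opposite. -/
def smooth (κ : Bool) (w : List Passage) (c : ℕ) : List Passage :=
  if κ then joinReversed (overToUnder w c) (underToOver w c)
  else joinReversed (underToOver w c) (overToUnder w c)

/-- The `(n,m)`-difference writhe `∇J_{n,m}(D)`. -/
def dwrithe₂ (κ : Bool) (n m : ℤ) (w : List Passage) : ℤ :=
  (∑ c ∈ crossings w with ind w c = m, sgn w c * ind w c * dwrithe n (smooth κ w c)) -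
    ∑ c ∈ crossings w with ind w c = -m, sgn w c * ind w c * dwrithe n (smooth κ w c)

/-! ## The polynomials -/

/-- The crossing `c` can be removed by a single first Reidemeister move. -/
def IsReducible (w : List Passage) (c : ℕ) : Prop :=
  ∃ (o : Bool) (s : ℤˣ) (v : List Passage), w ~r (⟨c, o, s⟩ :: ⟨c, !o, s⟩ :: v)

/-- The set `R(f, L)` of the values of a function `f` of crossings at the crossings, in any diagram
of the virtual knot `L` presented by `D`, that can be removed by a single first
Reidemeister move. -/
def reducedValues (f : List Passage → ℕ → ℤ) (D : Diagram) : Set ℤ :=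
  {g | ∃ D' : Diagram, Equivalent D D' ∧ ∃ c, IsReducible D'.word c ∧ f D'.word c = g}

open Classical in
/-- The set `T_n(D)` of the crossings `c` with `∇J_n(D_c) = ±∇J_n(D)`. -/
noncomputable def specialCrossings (κ : Bool) (n : ℤ) (D : Diagram) : Finset ℕ :=
  (crossings D.word).filter fun c =>
    dwrithe n (smooth κ D.word c) = dwrithe n D.word ∨
      dwrithe n (smooth κ D.word c) = -dwrithe n D.word

/-- The `n`-th `F`-polynomial `F^n(t, ℓ)`, a Laurent polynomial; `single (i, j) 1` is the monomial
`t ^ i * ℓ ^ j`. -/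
noncomputable def FPoly (κ : Bool) (n : ℤ) (D : Diagram) : ℤ[ℤ × ℤ] :=
  (∑ c ∈ crossings D.word,
      single (ind D.word c, dwrithe n (smooth κ D.word c)) (sgn D.word c)) -
    (∑ c ∈ specialCrossings κ n D,
      single (0, dwrithe n (smooth κ D.word c)) (sgn D.word c)) -
    ∑ c ∈ crossings D.word \ specialCrossings κ n D,
      single (0, dwrithe n D.word) (sgn D.word c)

open Classical in
/-- The set `T(D)` of the crossings at which `∇J_n(D_c)` and `∇J_{m,k}(D_c)` both lie in the
corresponding sets `R`. -/
noncomputable def specialCrossings₃ (κ : Bool) (n m k : ℤ) (D : Diagram) : Finset ℕ :=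
  (crossings D.word).filter fun c =>
    dwrithe n (smooth κ D.word c) ∈ reducedValues (fun w c => dwrithe n (smooth κ w c)) D ∧
      dwrithe₂ κ m k (smooth κ D.word c) ∈
        reducedValues (fun w c => dwrithe₂ κ m k (smooth κ w c)) D

/-- The polynomial `F^{n,m,k}(t, ℓ₁, ℓ₂)`, a Laurent polynomial; `single (i, j, l) 1` is the monomial
`t ^ i * ℓ₁ ^ j * ℓ₂ ^ l`. -/
noncomputable def FPoly₃ (κ : Bool) (n m k : ℤ) (D : Diagram) : ℤ[ℤ × ℤ × ℤ] :=
  (∑ c ∈ crossings D.word,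
      single (ind D.word c, dwrithe n (smooth κ D.word c), dwrithe₂ κ m k (smooth κ D.word c))
        (sgn D.word c)) -
    (∑ c ∈ specialCrossings₃ κ n m k D,
      single (0, dwrithe n (smooth κ D.word c), dwrithe₂ κ m k (smooth κ D.word c))
        (sgn D.word c)) -
    ∑ c ∈ crossings D.word \ specialCrossings₃ κ n m k D,
      single (0, dwrithe n D.word, dwrithe₂ κ m k D.word) (sgn D.word c)

/-- The Laurent polynomial `P(t, ℓ)` as the Laurent polynomial `P(t, ℓ₁)` in `t, ℓ₁, ℓ₂`. -/
noncomputable def inTwoOfThree (P : ℤ[ℤ × ℤ]) : ℤ[ℤ × ℤ × ℤ] :=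
  P.mapDomain fun e => (e.1, e.2, 0)

end VirtualKnot

/-!
The polynomials depend on over/under information only through the signs of the crossings. A passage
of the knot is recorded by its crossing and by the step `±1` of the arc label along it; this *flat*
word is unchanged by crossing changes. With `W(c) = sgn(c) Ind(c)`, a flat quantity,
`∇J_n(D) = ∑ c, ([W(c) = n] - [W(c) = -n])` and
`∇J_{n,m}(D) = ± ∑ c, W(c) ([W(c) = m] - [W(c) = -m]) ∇J_n(D_c)` for the flat smoothing `D_c`, where
the sign depends only on the convention for smoothings. Reversing the orientation negates `∇J_n`
and preserves `∇J_{n,m}`.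

For invariance, a flat move is compared with the smoothings of the two words. A crossing that
survives the move keeps its index, and its two smoothings are again related by moves
(`sameCrossing_kink`, `sameCrossing_bigon`, `sameCrossing_of_triangle`; in the last one the
smoothings at a corner of the triangle become equal after removing a bigon or renaming a crossing).
The crossing of a kink has index zero, and its smoothing is the rest of the word, possibly reversed.
The corners of a bigon have opposite `W`, and their smoothings are reverses of each other
(`bigon_crossings`). So in a sum over crossings the terms that a move creates cancel: applied once
this gives the invariance of `∇J_n` (`flatWrithe_eq`), applied to `∇J_n(D_c)` that of `∇J_{n,m}`
(`flatWrithe₂_eq`), and applied to both invariants of `D_c` that of the polynomials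
(`FPoly₃_invariant`).

The smoothing of a kink also determines the sets `R`: they are `{±∇J_n(D)}` and `{∇J_{m,k}(D)}`.
Hence `FPoly₃` is an explicit sum over crossings (`FPoly₃_eq`). If `k` exceeds the absolute values
of all indices of `D` and of its smoothings, then `∇J_{m,k}` vanishes on them, and `FPoly₃` becomes
`FPoly`. The examples are evaluated with the same formula; there, the vanishing of `∇J_n` for all `n`
at once is the symmetry of the multiset of the values `W(c)` under negation.
-/

namespace VirtualKnot

/-! ### Flat words -/

/-- A flat Gauss word: the passages of the knot through its crossings, each with the name of the
crossing and the change `±1` of the arc label along that passage. It forgets which strand is over,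
so a crossing change does not alter it. -/
abbrev FlatWord := List (ℕ × ℤˣ)

/-- Every passage occurs once, and with a passage also the other passage of the same crossing,
which has the opposite step. -/
def IsFlat (w : FlatWord) : Prop := w.Nodup ∧ ∀ p ∈ w, (p.1, -p.2) ∈ w

/-- The crossings of a flat word. -/
def flatCrossings (w : FlatWord) : Finset ℕ := (w.map Prod.fst).toFinset

/-- The total change of the arc label along a path. -/
def steps (w : FlatWord) : ℤ := (w.map fun p => (p.2 : ℤ)).sum

/-- `x` is the path from the passage of `c` with step `1` to the one with step `-1`, and `y` is the
path back. -/
def IsCut (w : FlatWord) (c : ℕ) (x y : FlatWord) : Prop :=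
  w ~r (c, 1) :: (x ++ (c, -1) :: y)

/-- Negate the step of a passage if its crossing lies in `S`. -/
def twist (S : Finset ℕ) (p : ℕ × ℤˣ) : ℕ × ℤˣ := if p.1 ∈ S then (p.1, -p.2) else p

/-- The crossings of the path `x` with the path `y`. -/
def shared (x y : FlatWord) : Finset ℕ := flatCrossings x ∩ flatCrossings y

/-- The flat counterpart of `joinReversed`: the closed curve that runs through `x` and then
backwards through `y`. Reversing one strand of a crossing negates the steps of both passages;
reversing both strands leaves them unchanged. -/
def flatJoin (x y : FlatWord) : FlatWord := (x ++ y.reverse).map (twist (shared x y))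

@[simp] lemma mem_flatCrossings {w : FlatWord} {c : ℕ} :
    c ∈ flatCrossings w ↔ ∃ s, (c, s) ∈ w := by
  simp [flatCrossings]

@[simp] lemma steps_nil : steps [] = 0 := rfl

@[simp] lemma steps_cons (p : ℕ × ℤˣ) (w : FlatWord) : steps (p :: w) = p.2 + steps w := by
  simp [steps]

@[simp] lemma steps_append (v w : FlatWord) : steps (v ++ w) = steps v + steps w := by
  simp [steps]

lemma steps_perm {v w : FlatWord} (h : v.Perm w) : steps v = steps w := (h.map _).sum_eq

@[simp] lemma steps_reverse (w : FlatWord) : steps w.reverse = steps w :=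
  steps_perm w.reverse_perm

lemma flatCrossings_perm {v w : FlatWord} (h : v.Perm w) : flatCrossings v = flatCrossings w := by
  ext c; simp [h.mem_iff]

lemma IsFlat.perm {v w : FlatWord} (hv : IsFlat v) (h : v.Perm w) : IsFlat w :=
  ⟨h.nodup_iff.1 hv.1, fun p hp => h.mem_iff.1 (hv.2 p (h.mem_iff.2 hp))⟩

lemma IsFlat.steps_eq_zero {w : FlatWord} (h : IsFlat w) : steps w = 0 := by
  rw [steps, ← List.sum_toFinset _ h.1]
  refine Finset.sum_involution (fun p _ => (p.1, -p.2)) ?_ ?_ ?_ ?_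
  · intro p _; simp
  · rintro ⟨c, s⟩ _ _ h
    rcases Int.units_eq_one_or s with rfl | rfl <;> simp at h
  · intro p hp; simpa using h.2 p (by simpa using hp)
  · intro p _; simp

lemma IsFlat.of_append_right {u v : FlatWord} (h : IsFlat (u ++ v)) (hu : IsFlat u) :
    IsFlat v := by
  obtain ⟨h1, h2⟩ := h
  rw [List.nodup_append'] at h1
  refine ⟨h1.2.1, fun p hp => ?_⟩
  rcases List.mem_append.1 (h2 p (by simp [hp])) with h | h
  · exact (h1.2.2 (by simpa using hu.2 _ h) hp).elim
  · exact h

lemma isFlat_pair (a : ℕ) (s : ℤˣ) : IsFlat [(a, s), (a, -s)] := by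
  constructor
  · rcases Int.units_eq_one_or s with rfl | rfl <;> simp
  · simp

lemma mem_both_of_mem {w : FlatWord} (h : IsFlat w) {c : ℕ} (hc : c ∈ flatCrossings w) (s : ℤˣ) :
    (c, s) ∈ w := by
  obtain ⟨t, ht⟩ := mem_flatCrossings.1 hc
  rcases Int.units_eq_one_or s with rfl | rfl <;> rcases Int.units_eq_one_or t with rfl | rfl
  · exact ht
  · simpa using h.2 _ ht
  · simpa using h.2 _ ht
  · exact ht

/-- A crossing both of whose passages lie in one part of a word does not occur in the other. -/
lemma notMem_of_append {u v : FlatWord} (h : (u ++ v).Nodup) (hu : IsFlat u) {c : ℕ}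
    (hc : c ∈ flatCrossings u) : c ∉ flatCrossings v := by
  intro h'
  obtain ⟨s, hs⟩ := mem_flatCrossings.1 h'
  exact (List.nodup_append'.1 h).2.2 (mem_both_of_mem hu hc s) hs

/-! ### Twisting -/

@[simp] lemma twist_fst (S : Finset ℕ) (p : ℕ × ℤˣ) : (twist S p).1 = p.1 := by
  unfold twist; split_ifs <;> rfl

@[simp] lemma twist_twist (S : Finset ℕ) (p : ℕ × ℤˣ) : twist S (twist S p) = p := by
  by_cases h : p.1 ∈ S <;> simp [twist, h]

lemma twist_mem {S : Finset ℕ} {c : ℕ} (h : c ∈ S) (s : ℤˣ) : twist S (c, s) = (c, -s) := by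
  simp [twist, h]

lemma twist_notMem {S : Finset ℕ} {c : ℕ} (h : c ∉ S) (s : ℤˣ) : twist S (c, s) = (c, s) := by
  simp [twist, h]

lemma twist_neg (S : Finset ℕ) (p : ℕ × ℤˣ) :
    twist S (p.1, -p.2) = ((twist S p).1, -(twist S p).2) := by
  by_cases h : p.1 ∈ S <;> simp [twist, h]

lemma twist_injective (S : Finset ℕ) : Function.Injective (twist S) :=
  Function.LeftInverse.injective (g := twist S) (twist_twist S)

lemma map_twist_congr {S T : Finset ℕ} {w : FlatWord}
    (h : ∀ c ∈ flatCrossings w, c ∈ S ↔ c ∈ T) : w.map (twist S) = w.map (twist T) := by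
  refine List.map_congr_left fun p hp => ?_
  have := h p.1 (mem_flatCrossings.2 ⟨p.2, hp⟩)
  simp [twist, this]

lemma map_twist_eq_self {S : Finset ℕ} {w : FlatWord}
    (h : ∀ c ∈ flatCrossings w, c ∉ S) : w.map (twist S) = w := by
  refine (List.map_congr_left fun p hp => ?_).trans (List.map_id w)
  simp [twist, h p.1 (mem_flatCrossings.2 ⟨p.2, hp⟩)]

@[simp] lemma flatCrossings_map_twist (S : Finset ℕ) (w : FlatWord) :
    flatCrossings (w.map (twist S)) = flatCrossings w := by
  simp [flatCrossings, Function.comp_def]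

lemma IsFlat.map_twist {w : FlatWord} (h : IsFlat w) (S : Finset ℕ) :
    IsFlat (w.map (twist S)) := by
  refine ⟨h.1.map (twist_injective S), fun p hp => ?_⟩
  obtain ⟨q, hq, rfl⟩ := List.mem_map.1 hp
  rw [← twist_neg]
  exact List.mem_map_of_mem (h.2 q hq)

lemma shared_comm (x y : FlatWord) : shared x y = shared y x := Finset.inter_comm _ _

lemma flatJoin_perm (x y : FlatWord) :
    (flatJoin x y).Perm ((x ++ y).map (twist (shared x y))) :=
  ((List.Perm.refl x).append y.reverse_perm).map _

lemma isFlat_flatJoin {x y : FlatWord} (h : IsFlat (x ++ y)) : IsFlat (flatJoin x y) :=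
  (h.map_twist _).perm (flatJoin_perm x y).symm

lemma flatJoin_reverse (x y : FlatWord) : (flatJoin x y).reverse = flatJoin y x := by
  simp [flatJoin, shared_comm x y]

/-! ### Cutting -/

lemma isRotated_iff_append {α : Type*} {v w : List α} :
    v ~r w ↔ ∃ a b, v = a ++ b ∧ w = b ++ a := by
  constructor
  · intro h
    obtain ⟨n, hn, rfl⟩ := List.isRotated_iff_mod.1 h
    exact ⟨v.take n, v.drop n, (List.take_append_drop _ _).symm,
      List.rotate_eq_drop_append_take hn⟩
  · rintro ⟨a, b, rfl, rfl⟩; exact List.isRotated_append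

lemma eq_of_isRotated_cons {α : Type*} {a : α} {v w : List α} (hv : (a :: v).Nodup)
    (h : a :: v ~r a :: w) : v = w := by
  obtain ⟨x, y, h1, h2⟩ := isRotated_iff_append.1 h
  rcases x with _ | ⟨p, x⟩
  · simp at h1 h2; rw [← h1] at h2; simpa using h2.symm
  rcases y with _ | ⟨q, y⟩
  · simp at h1 h2; rw [h1.2, h2.2]
  simp only [List.cons_append, List.cons.injEq] at h1 h2
  obtain ⟨rfl, rfl⟩ := h1
  simp [h2.1] at hv

lemma append_cons_inj {α : Type*} {a : α} {v w v' w' : List α} (h : (v ++ a :: w).Nodup)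
    (e : v ++ a :: w = v' ++ a :: w') : v = v' ∧ w = w' := by
  have h' : (v' ++ a :: w').Nodup := e ▸ h
  have h1 : a ∉ v := fun ha => (List.nodup_append'.1 h).2.2 ha (by simp)
  have h2 : a ∉ v' := fun ha => (List.nodup_append'.1 h').2.2 ha (by simp)
  have := (List.append_eq_append_iff.1 e)
  rcases this with ⟨z, hz, hz'⟩ | ⟨z, hz, hz'⟩
  · rcases z with _ | ⟨q, z⟩
    · simp at hz hz'; exact ⟨hz.symm, hz'⟩
    · simp at hz'; rw [hz, hz'.1] at h2; simp at h2
  · rcases z with _ | ⟨q, z⟩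
    · simp at hz hz'; exact ⟨hz, hz'.symm⟩
    · simp at hz'; rw [hz, hz'.1] at h1; simp at h1

lemma IsCut.unique {w : FlatWord} (hw : IsFlat w) {c : ℕ} {x y x' y' : FlatWord}
    (h : IsCut w c x y) (h' : IsCut w c x' y') : x = x' ∧ y = y' := by
  have hn : ((c, (1 : ℤˣ)) :: (x ++ (c, -1) :: y)).Nodup := h.nodup_iff.1 hw.1
  have := eq_of_isRotated_cons hn (h.symm.trans h')
  exact append_cons_inj (List.nodup_cons.1 hn).2 this

lemma exists_isCut {w : FlatWord} (hw : IsFlat w) {c : ℕ} (hc : c ∈ flatCrossings w) :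
    ∃ x y, IsCut w c x y := by
  obtain ⟨A, B, rfl⟩ := List.append_of_mem (mem_both_of_mem hw hc 1)
  have h2 := mem_both_of_mem hw hc (-1)
  have h3 : (c, (-1 : ℤˣ)) ∈ B ++ A := by
    simp only [List.mem_append, List.mem_cons] at h2 ⊢
    rcases h2 with h | h | h
    · exact Or.inr h
    · simp at h
    · exact Or.inl h
  obtain ⟨x, y, h⟩ := List.append_of_mem h3
  refine ⟨x, y, ?_⟩
  rw [IsCut, ← h]
  simpa using List.isRotated_append (l := A) (l' := (c, 1) :: B)

open Classical in
/-- The two paths into which the crossing `c` cuts a flat word (empty if `c` does not occur). They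
are unique by `IsCut.unique`. -/
noncomputable def halves (w : FlatWord) (c : ℕ) : FlatWord × FlatWord :=
  if h : ∃ z : FlatWord × FlatWord, IsCut w c z.1 z.2 then h.choose else ([], [])

lemma IsCut.halves_eq {w : FlatWord} (hw : IsFlat w) {c : ℕ} {x y : FlatWord}
    (h : IsCut w c x y) : halves w c = (x, y) := by
  have h' : ∃ z : FlatWord × FlatWord, IsCut w c z.1 z.2 := ⟨(x, y), h⟩
  rw [halves, dif_pos h']
  have := IsCut.unique hw h'.choose_spec h
  exact Prod.ext this.1 this.2

/-- The index of a crossing of a flat word; it is the index of a knot diagram up to the sign of the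
crossing, see `ind_and_smooth`. -/
noncomputable def flatIndex (w : FlatWord) (c : ℕ) : ℤ := steps (halves w c).1

/-- Smoothing of a flat word at `c` against the orientation; the path that keeps its orientation is
the one that starts at the passage of step `1`. -/
noncomputable def flatSmooth (w : FlatWord) (c : ℕ) : FlatWord :=
  flatJoin (halves w c).1 (halves w c).2

lemma IsCut.flatIndex_eq {w : FlatWord} (hw : IsFlat w) {c : ℕ} {x y : FlatWord}
    (h : IsCut w c x y) : flatIndex w c = steps x := by
  rw [flatIndex, h.halves_eq hw]

lemma IsCut.flatSmooth_eq {w : FlatWord} (hw : IsFlat w) {c : ℕ} {x y : FlatWord}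
    (h : IsCut w c x y) : flatSmooth w c = flatJoin x y := by
  rw [flatSmooth, h.halves_eq hw]

lemma IsCut.isFlat {w : FlatWord} (hw : IsFlat w) {c : ℕ} {x y : FlatWord}
    (h : IsCut w c x y) : IsFlat (x ++ y) := by
  have : w.Perm ([(c, 1), (c, -1)] ++ (x ++ y)) := by
    refine h.perm.trans ?_
    simp
  exact (hw.perm this).of_append_right (isFlat_pair c 1)

lemma isFlat_flatSmooth {w : FlatWord} (hw : IsFlat w) {c : ℕ} (hc : c ∈ flatCrossings w) :
    IsFlat (flatSmooth w c) := by
  obtain ⟨x, y, h⟩ := exists_isCut hw hc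
  rw [h.flatSmooth_eq hw]
  exact isFlat_flatJoin (h.isFlat hw)

lemma IsCut.steps_add {w : FlatWord} (hw : IsFlat w) {c : ℕ} {x y : FlatWord}
    (h : IsCut w c x y) : steps x + steps y = 0 := by
  simpa using (h.isFlat hw).steps_eq_zero

/-- The passages `p`, `q`, in this order if `ε = 1` and in the opposite order if `ε = -1`. -/
def flatOrd (ε : ℤˣ) (p q : ℕ × ℤˣ) : FlatWord := if ε = 1 then [p, q] else [q, p]

/-- `P` and `Q` are the two sides of a flat bigon with corners `a` and `b`, in the order in which
they are run through. -/
def IsBigon (a b : ℕ) (P Q : FlatWord) : Prop :=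
  ∃ s : ℤˣ, (P = [(a, s), (b, -s)] ∨ P = [(b, -s), (a, s)]) ∧
    (Q = [(a, -s), (b, s)] ∨ Q = [(b, s), (a, -s)])

/-- `P`, `Q`, `R` are the sides of a flat triangle. The first strand meets `a` and `b`, the second
`c` and `a`, the third `b` and `c`; `u`, `v`, `t` are the steps of the earlier strand at `a`, `b`,
`c`. This form of the condition is invariant under cyclic permutations of the strands, while a
transposition negates `ε`, so that no over/under information is needed. -/
def IsTriangle (a b c : ℕ) (P Q R : FlatWord) : Prop :=
  ∃ ε u v t : ℤˣ, P = flatOrd (ε * u * v) (a, u) (b, v) ∧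
    Q = flatOrd (-(ε * u * t)) (c, t) (a, -u) ∧ R = flatOrd (ε * v * t) (b, -v) (c, -t)

/-- The Reidemeister moves of flat words. One constructor covers the third move, since the strands
may be numbered in the order of their appearance. -/
inductive FlatMove : FlatWord → FlatWord → Prop
  | rotate (w w' : FlatWord) (h : w ~r w') : FlatMove w w'
  | relabel (f : ℕ → ℕ) (hf : Function.Injective f) (w : FlatWord) :
      FlatMove w (w.map fun p => (f p.1, p.2))
  | r1 (a : ℕ) (s : ℤˣ) (v : FlatWord) : FlatMove ((a, s) :: (a, -s) :: v) v
  | r2 (a b : ℕ) (P Q x y : FlatWord) (h : IsBigon a b P Q) :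
      FlatMove (P ++ (x ++ (Q ++ y))) (x ++ y)
  | r3 (a b c : ℕ) (P Q R x y z : FlatWord) (h : IsTriangle a b c P Q R) :
      FlatMove (P ++ (x ++ (Q ++ (y ++ (R ++ z)))))
        (P.reverse ++ (x ++ (Q.reverse ++ (y ++ (R.reverse ++ z)))))

/-- Equivalence of flat words, through words in which every crossing occurs twice. -/
def FlatEq : FlatWord → FlatWord → Prop :=
  Relation.EqvGen fun w w' => IsFlat w ∧ FlatMove w w'

/-! ### Bigons and triangles -/

lemma flatOrd_reverse (ε : ℤˣ) (p q : ℕ × ℤˣ) : (flatOrd ε p q).reverse = flatOrd (-ε) p q := by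
  rcases Int.units_eq_one_or ε with rfl | rfl <;> simp [flatOrd]

lemma flatOrd_swap (ε : ℤˣ) (p q : ℕ × ℤˣ) : flatOrd ε p q = flatOrd (-ε) q p := by
  rcases Int.units_eq_one_or ε with rfl | rfl <;> simp [flatOrd]

lemma flatOrd_map (f : ℕ × ℤˣ → ℕ × ℤˣ) (ε : ℤˣ) (p q : ℕ × ℤˣ) :
    (flatOrd ε p q).map f = flatOrd ε (f p) (f q) := by
  unfold flatOrd; split_ifs <;> rfl

lemma flatCrossings_flatOrd (ε : ℤˣ) (p q : ℕ × ℤˣ) :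
    flatCrossings (flatOrd ε p q) = {p.1, q.1} := by
  unfold flatOrd; split_ifs
  · simp [flatCrossings]
  · simp [flatCrossings, Finset.pair_comm]

lemma IsBigon.symm {a b : ℕ} {P Q : FlatWord} (h : IsBigon a b P Q) : IsBigon a b Q P := by
  obtain ⟨s, hP, hQ⟩ := h
  exact ⟨-s, by simpa using hQ, by simpa using hP⟩

lemma IsBigon.reverse {a b : ℕ} {P Q : FlatWord} (h : IsBigon a b P Q) :
    IsBigon a b P.reverse Q.reverse := by
  obtain ⟨s, rfl | rfl, rfl | rfl⟩ := h <;> exact ⟨s, by simp, by simp⟩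

lemma IsBigon.reverse_right {a b : ℕ} {P Q : FlatWord} (h : IsBigon a b P Q) :
    IsBigon a b P Q.reverse := by
  obtain ⟨s, hP, rfl | rfl⟩ := h <;> exact ⟨s, hP, by simp⟩

/-- A twist of neither or of both corners keeps a bigon. -/
lemma IsBigon.twist {a b : ℕ} {P Q : FlatWord} (h : IsBigon a b P Q) {S : Finset ℕ}
    (hS : a ∈ S ↔ b ∈ S) : IsBigon a b (P.map (twist S)) (Q.map (twist S)) := by
  by_cases ha : a ∈ S
  · have hb := hS.1 ha
    obtain ⟨s, rfl | rfl, rfl | rfl⟩ := h <;>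
      exact ⟨-s, by simp [twist_mem ha, twist_mem hb], by simp [twist_mem ha, twist_mem hb]⟩
  · have hb := fun h => ha (hS.2 h)
    obtain ⟨s, rfl | rfl, rfl | rfl⟩ := h <;>
      exact ⟨s, by simp [twist_notMem ha, twist_notMem hb],
        by simp [twist_notMem ha, twist_notMem hb]⟩

lemma IsBigon.flatCrossings_left {a b : ℕ} {P Q : FlatWord} (h : IsBigon a b P Q) :
    flatCrossings P = {a, b} := by
  obtain ⟨s, rfl | rfl, -⟩ := h
  · simp [flatCrossings]
  · simp [flatCrossings, Finset.pair_comm]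

lemma IsBigon.flatCrossings_right {a b : ℕ} {P Q : FlatWord} (h : IsBigon a b P Q) :
    flatCrossings Q = {a, b} := h.symm.flatCrossings_left

lemma IsBigon.steps_left {a b : ℕ} {P Q : FlatWord} (h : IsBigon a b P Q) : steps P = 0 := by
  obtain ⟨s, rfl | rfl, -⟩ := h <;> simp

lemma IsBigon.steps_right {a b : ℕ} {P Q : FlatWord} (h : IsBigon a b P Q) : steps Q = 0 :=
  h.symm.steps_left

lemma IsBigon.perm {a b : ℕ} {P Q : FlatWord} (h : IsBigon a b P Q) :
    ∃ s, (P ++ Q).Perm ([(a, s), (a, -s)] ++ [(b, s), (b, -s)]) := by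
  obtain ⟨s, hP, hQ⟩ := h
  have h1 : P.Perm [(a, s), (b, -s)] := by
    rcases hP with rfl | rfl
    · rfl
    · exact List.Perm.swap _ _ _
  have h2 : Q.Perm [(a, -s), (b, s)] := by
    rcases hQ with rfl | rfl
    · rfl
    · exact List.Perm.swap _ _ _
  refine ⟨s, (h1.append h2).trans ?_⟩
  simp only [List.cons_append, List.nil_append]
  refine List.Perm.cons _ ?_
  exact (List.Perm.swap (a, -s) (b, -s) _).trans (List.Perm.cons _ (List.Perm.swap _ _ _))

lemma IsBigon.isFlat {a b : ℕ} {P Q x : FlatWord} (h : IsBigon a b P Q)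
    (hw : IsFlat (P ++ Q ++ x)) : IsFlat (P ++ Q) ∧ a ≠ b := by
  obtain ⟨s, hs⟩ := h.perm
  have h1 : ([(a, s), (a, -s)] ++ [(b, s), (b, -s)]).Nodup :=
    hs.nodup_iff.1 (List.nodup_append'.1 hw.1).1
  refine ⟨IsFlat.perm ⟨h1, ?_⟩ hs.symm, ?_⟩
  · intro p hp
    simp only [List.cons_append, List.nil_append, List.mem_cons, List.not_mem_nil, or_false] at hp
    rcases hp with rfl | rfl | rfl | rfl <;> simp
  · rintro rfl; simp at h1

lemma IsTriangle.rotate {a b c : ℕ} {P Q R : FlatWord} (h : IsTriangle a b c P Q R) :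
    IsTriangle c a b Q R P := by
  obtain ⟨ε, u, v, t, rfl, rfl, rfl⟩ := h
  refine ⟨ε, t, -u, -v, ?_, ?_, ?_⟩
  · congr 1; rw [mul_neg]; congr 1; rw [mul_right_comm]
  · simp [mul_right_comm]
  · simp

lemma IsTriangle.swap {a b c : ℕ} {P Q R : FlatWord} (h : IsTriangle a b c P Q R) :
    IsTriangle b a c P R Q := by
  obtain ⟨ε, u, v, t, rfl, rfl, rfl⟩ := h
  refine ⟨-ε, v, u, -t, ?_, ?_, ?_⟩
  · rw [flatOrd_swap]; congr 1; simp [mul_right_comm]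
  · rw [flatOrd_swap]; simp
  · rw [flatOrd_swap]; simp

lemma IsTriangle.reverse {a b c : ℕ} {P Q R : FlatWord} (h : IsTriangle a b c P Q R) :
    IsTriangle a b c P.reverse Q.reverse R.reverse := by
  obtain ⟨ε, u, v, t, rfl, rfl, rfl⟩ := h
  refine ⟨-ε, u, v, t, ?_, ?_, ?_⟩ <;> rw [flatOrd_reverse] <;> simp

/-- Reversing the first strand of a triangle twists the two crossings on it and gives a triangle. -/
lemma IsTriangle.reverse_one {a b c : ℕ} {P Q R : FlatWord} (h : IsTriangle a b c P Q R)
    {S : Finset ℕ} (ha : a ∈ S) (hb : b ∈ S) (hc : c ∉ S) :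
    IsTriangle a b c (P.reverse.map (twist S)) (Q.map (twist S)) (R.map (twist S)) := by
  obtain ⟨ε, u, v, t, rfl, rfl, rfl⟩ := h
  refine ⟨-ε, -u, -v, t, ?_, ?_, ?_⟩ <;>
    simp [flatOrd_reverse, flatOrd_map, twist_mem ha, twist_mem hb, twist_notMem hc]

/-- Reversing all strands of a triangle twists no crossing and gives a triangle. -/
lemma IsTriangle.reverse_all {a b c : ℕ} {P Q R : FlatWord} (h : IsTriangle a b c P Q R)
    {S : Finset ℕ} (ha : a ∉ S) (hb : b ∉ S) (hc : c ∉ S) :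
    IsTriangle a b c (P.reverse.map (twist S)) (Q.reverse.map (twist S))
      (R.reverse.map (twist S)) := by
  obtain ⟨ε, u, v, t, rfl, rfl, rfl⟩ := h
  refine ⟨-ε, u, v, t, ?_, ?_, ?_⟩ <;>
    simp [flatOrd_reverse, flatOrd_map, twist_notMem ha, twist_notMem hb, twist_notMem hc]

lemma IsTriangle.flatCrossings_left {a b c : ℕ} {P Q R : FlatWord} (h : IsTriangle a b c P Q R) :
    flatCrossings P = {a, b} := by
  obtain ⟨ε, u, v, t, rfl, -, -⟩ := h
  simp [flatCrossings_flatOrd]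

lemma IsTriangle.flatCrossings_middle {a b c : ℕ} {P Q R : FlatWord}
    (h : IsTriangle a b c P Q R) : flatCrossings Q = {c, a} := h.rotate.flatCrossings_left

lemma IsTriangle.flatCrossings_right {a b c : ℕ} {P Q R : FlatWord}
    (h : IsTriangle a b c P Q R) : flatCrossings R = {b, c} := h.rotate.rotate.flatCrossings_left

/-! ### Flat equivalence -/

lemma IsFlat.map_relabel {w : FlatWord} (h : IsFlat w) {f : ℕ → ℕ} (hf : Function.Injective f) :
    IsFlat (w.map fun p => (f p.1, p.2)) := by
  refine ⟨h.1.map fun p q e => ?_, fun p hp => ?_⟩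
  · simp only [Prod.mk.injEq] at e; exact Prod.ext (hf e.1) e.2
  · obtain ⟨q, hq, rfl⟩ := List.mem_map.1 hp
    exact List.mem_map_of_mem (f := fun p : ℕ × ℤˣ => (f p.1, p.2)) (h.2 q hq)

lemma perm_bigon (P Q x y : FlatWord) : (P ++ (x ++ (Q ++ y))).Perm (P ++ Q ++ (x ++ y)) := by
  simp only [List.append_assoc]
  refine List.Perm.append_left _ ?_
  rw [← List.append_assoc, ← List.append_assoc]
  exact List.Perm.append_right _ List.perm_append_comm

lemma perm_triangle (P Q R x y z : FlatWord) :
    (P ++ (x ++ (Q ++ (y ++ (R ++ z))))).Perm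
      (P.reverse ++ (x ++ (Q.reverse ++ (y ++ (R.reverse ++ z))))) :=
  P.reverse_perm.symm.append <| .append_left _ <| Q.reverse_perm.symm.append <| .append_left _ <|
    R.reverse_perm.symm.append_right _

lemma IsFlat.of_move {w w' : FlatWord} (h : IsFlat w) (m : FlatMove w w') : IsFlat w' := by
  cases m with
  | rotate _ _ hr => exact h.perm hr.perm
  | relabel f hf => exact h.map_relabel hf
  | r1 a s => exact IsFlat.of_append_right (u := [(a, s), (a, -s)]) h (isFlat_pair a s)
  | r2 a b P Q x y hb =>
    have := h.perm (perm_bigon P Q x y)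
    exact this.of_append_right (hb.isFlat this).1
  | r3 a b c P Q R x y z ht => exact h.perm (perm_triangle P Q R x y z)

namespace FlatEq

lemma refl (w : FlatWord) : FlatEq w w := Relation.EqvGen.refl w

lemma symm {v w : FlatWord} (h : FlatEq v w) : FlatEq w v := Relation.EqvGen.symm _ _ h

lemma trans {u v w : FlatWord} (h : FlatEq u v) (h' : FlatEq v w) : FlatEq u w :=
  Relation.EqvGen.trans _ _ _ h h'

lemma of_move {v w : FlatWord} (hv : IsFlat v) (h : FlatMove v w) : FlatEq v w :=
  Relation.EqvGen.rel _ _ ⟨hv, h⟩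

lemma of_rotated {v w : FlatWord} (hv : IsFlat v) (h : v ~r w) : FlatEq v w :=
  of_move hv (.rotate _ _ h)

lemma of_move_rotated {v w v' w' : FlatWord} (hv : IsFlat v) (m : FlatMove v' w') (h : v ~r v')
    (h' : w' ~r w) : FlatEq v w :=
  (of_rotated hv h).trans ((of_move (hv.perm h.perm) m).trans
    (of_rotated ((hv.perm h.perm).of_move m) h'))

end FlatEq

lemma IsFlat.reverse {w : FlatWord} (h : IsFlat w) : IsFlat w.reverse :=
  h.perm w.reverse_perm.symm

lemma FlatMove.reverse {v w : FlatWord} (m : FlatMove v w) (hv : IsFlat v) :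
    FlatEq v.reverse w.reverse := by
  cases m with
  | rotate _ _ h => exact .of_rotated hv.reverse h.reverse
  | relabel f hf =>
    rw [← List.map_reverse]; exact .of_move hv.reverse (.relabel f hf _)
  | r1 a s v =>
    refine .of_move_rotated hv.reverse (.r1 a (-s) w.reverse) ?_ (.refl _)
    simpa using List.isRotated_append (l := w.reverse) (l' := [(a, -s), (a, s)])
  | r2 a b P Q x y h =>
    refine .of_move_rotated hv.reverse (.r2 a b P.reverse Q.reverse y.reverse x.reverse
      h.reverse) ?_ ?_
    · simpa using List.isRotated_append (l := y.reverse ++ Q.reverse ++ x.reverse)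
        (l' := P.reverse)
    · rw [List.reverse_append]
  | r3 a b c P Q R x y z h =>
    refine .of_move_rotated hv.reverse (.r3 b a c P.reverse R.reverse Q.reverse z.reverse
      y.reverse x.reverse h.swap.reverse) ?_ ?_
    · simpa using List.isRotated_append
        (l := z.reverse ++ R.reverse ++ y.reverse ++ Q.reverse ++ x.reverse) (l' := P.reverse)
    · simpa using List.isRotated_append (l := P)
        (l' := z.reverse ++ R ++ y.reverse ++ Q ++ x.reverse)

lemma FlatEq.reverse {v w : FlatWord} (h : FlatEq v w) : FlatEq v.reverse w.reverse := by
  induction h with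
  | rel v w h => exact h.2.reverse h.1
  | refl => exact .refl _
  | symm _ _ _ ih => exact ih.symm
  | trans _ _ _ _ _ ih ih' => exact ih.trans ih'

lemma IsCut.reverse {w : FlatWord} {c : ℕ} {x y : FlatWord} (h : IsCut w c x y) :
    IsCut w.reverse c y.reverse x.reverse := by
  refine (List.IsRotated.reverse h).trans ?_
  simpa using List.isRotated_append (l := y.reverse ++ (c, -1) :: x.reverse) (l' := [(c, 1)])

lemma shared_reverse (x y : FlatWord) : shared x.reverse y.reverse = shared x y := by
  simp [shared, flatCrossings]

lemma flatIndex_reverse {w : FlatWord} (hw : IsFlat w) {c : ℕ} (hc : c ∈ flatCrossings w) :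
    flatIndex w.reverse c = -flatIndex w c := by
  obtain ⟨x, y, h⟩ := exists_isCut hw hc
  have := h.steps_add hw
  rw [h.flatIndex_eq hw, h.reverse.flatIndex_eq hw.reverse, steps_reverse]
  linarith

lemma flatSmooth_reverse {w : FlatWord} (hw : IsFlat w) {c : ℕ} (hc : c ∈ flatCrossings w) :
    FlatEq (flatSmooth w.reverse c) (flatSmooth w c) := by
  obtain ⟨x, y, h⟩ := exists_isCut hw hc
  rw [h.flatSmooth_eq hw, h.reverse.flatSmooth_eq hw.reverse]
  refine .of_rotated (isFlat_flatJoin (h.reverse.isFlat hw.reverse)) ?_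
  rw [flatJoin, flatJoin, shared_reverse, shared_comm, List.reverse_reverse]
  exact List.IsRotated.map List.isRotated_append _

@[simp] lemma flatCrossings_nil : flatCrossings [] = ∅ := rfl

@[simp] lemma flatCrossings_cons (p : ℕ × ℤˣ) (w : FlatWord) :
    flatCrossings (p :: w) = insert p.1 (flatCrossings w) := by
  simp [flatCrossings]

@[simp] lemma flatCrossings_append (v w : FlatWord) :
    flatCrossings (v ++ w) = flatCrossings v ∪ flatCrossings w := by
  simp [flatCrossings]

@[simp] lemma flatCrossings_reverse (w : FlatWord) :
    flatCrossings w.reverse = flatCrossings w := by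
  simp [flatCrossings]

lemma mem_flatOrd {ε : ℤˣ} {p q r : ℕ × ℤˣ} : r ∈ flatOrd ε p q ↔ r = p ∨ r = q := by
  unfold flatOrd; split_ifs
  · simp
  · simp [or_comm]

/-! ### New crossings of the moves -/

lemma notMem_kink {a : ℕ} {s : ℤˣ} {v w : FlatWord} (hw : IsFlat w)
    (h : w.Perm ((a, s) :: (a, -s) :: v)) : a ∉ flatCrossings v :=
  notMem_of_append (u := [(a, s), (a, -s)]) (hw.perm h).1 (isFlat_pair a s) (by simp)

lemma IsBigon.notMem {a b : ℕ} {P Q v w : FlatWord} (hb : IsBigon a b P Q) (hw : IsFlat w)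
    (h : w.Perm (P ++ Q ++ v)) : a ∉ flatCrossings v ∧ b ∉ flatCrossings v := by
  have h1 := hw.perm h
  have h2 := (hb.isFlat h1).1
  constructor <;> refine notMem_of_append h1.1 h2 ?_ <;>
    simp [hb.flatCrossings_left]

lemma IsTriangle.isFlat {a b c : ℕ} {P Q R v : FlatWord} (ht : IsTriangle a b c P Q R)
    (h : IsFlat (P ++ Q ++ R ++ v)) : IsFlat (P ++ Q ++ R) := by
  refine ⟨(List.nodup_append'.1 h.1).1, fun p hp => ?_⟩
  obtain ⟨ε, u, v, t, rfl, rfl, rfl⟩ := ht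
  simp only [List.mem_append, mem_flatOrd] at hp ⊢
  rcases hp with (((rfl | rfl) | (rfl | rfl)) | (rfl | rfl)) <;> simp

lemma IsTriangle.notMem {a b c : ℕ} {P Q R v w : FlatWord} (ht : IsTriangle a b c P Q R)
    (hw : IsFlat w) (h : w.Perm (P ++ Q ++ R ++ v)) :
    a ∉ flatCrossings v ∧ b ∉ flatCrossings v ∧ c ∉ flatCrossings v := by
  have h1 := hw.perm h
  have h2 := ht.isFlat h1
  refine ⟨?_, ?_, ?_⟩ <;> refine notMem_of_append h1.1 h2 ?_ <;>
    simp [ht.flatCrossings_left, ht.flatCrossings_middle]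

lemma IsTriangle.ne {a b c : ℕ} {P Q R v w : FlatWord} (ht : IsTriangle a b c P Q R)
    (hw : IsFlat w) (h : w.Perm (P ++ Q ++ R ++ v)) : a ≠ b := by
  rintro rfl
  have h1 : (P ++ Q).Nodup := (List.nodup_append'.1 (List.nodup_append'.1 (hw.perm h).1).1).1
  obtain ⟨ε, u, v, t, rfl, rfl, rfl⟩ := ht
  have h2 := List.nodup_append'.1 h1
  rcases Int.units_eq_one_or u with rfl | rfl <;> rcases Int.units_eq_one_or v with rfl | rfl
  · have := h2.1; unfold flatOrd at this; split_ifs at this <;> simp at this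
  · exact h2.2.2 (mem_flatOrd.2 (.inr rfl)) (mem_flatOrd.2 (.inr rfl))
  · exact h2.2.2 (mem_flatOrd.2 (.inr rfl)) (mem_flatOrd.2 (.inr (by simp)))
  · have := h2.1; unfold flatOrd at this; split_ifs at this <;> simp at this

lemma perm_triangle_front (P Q R x y z : FlatWord) :
    (P ++ (x ++ (Q ++ (y ++ (R ++ z))))).Perm (P ++ Q ++ R ++ (x ++ (y ++ z))) := by
  rw [← Multiset.coe_eq_coe]
  simp only [← Multiset.coe_add]
  abel

/-! ### Smoothing of words that differ by a move -/

lemma flatJoin_kink {a : ℕ} {s : ℤˣ} {x y z : FlatWord}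
    (h : IsFlat (x ++ (y ++ ((a, s) :: (a, -s) :: z)))) :
    FlatEq (flatJoin x (y ++ ((a, s) :: (a, -s) :: z))) (flatJoin x (y ++ z)) := by
  have hp : (x ++ (y ++ ((a, s) :: (a, -s) :: z))).Perm ((a, s) :: (a, -s) :: (x ++ (y ++ z))) := by
    rw [← Multiset.coe_eq_coe]
    simp only [← Multiset.coe_add, ← Multiset.cons_coe, Multiset.add_cons]
  have ha := notMem_kink h hp
  have hx : a ∉ flatCrossings x := fun h => ha (by simp only [flatCrossings_append]; simp [h])
  set S := shared x (y ++ ((a, s) :: (a, -s) :: z)) with hS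
  have haS : a ∉ S := fun h => hx (Finset.mem_inter.1 h).1
  have e : flatJoin x (y ++ z) = (x ++ (y ++ z).reverse).map (twist S) := by
    refine map_twist_congr fun c hc => ?_
    have hca : c ≠ a := by
      rintro rfl; exact ha (by simpa only [flatCrossings_append, flatCrossings_reverse] using hc)
    simp only [hS, shared, flatCrossings_append, flatCrossings_cons, Finset.mem_inter,
      Finset.mem_union, Finset.mem_insert]
    tauto
  rw [e]
  refine .of_move_rotated (isFlat_flatJoin h) (.r1 a (-s)
    ((y.reverse ++ (x ++ z.reverse)).map (twist S))) ?_ ?_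
  · rw [flatJoin, ← hS]
    simpa [twist_notMem haS] using List.isRotated_append (l := (x ++ z.reverse).map (twist S))
      (l' := [(a, -s), (a, s)] ++ y.reverse.map (twist S))
  · refine List.IsRotated.map ?_ _
    simpa using List.isRotated_append (l := y.reverse) (l' := x ++ z.reverse)

/-- Both sides of the bigon lie on the reversed path. -/
lemma flatJoin_bigon_side {a b : ℕ} {P Q x y z v : FlatWord} (hb : IsBigon a b P Q)
    (h : IsFlat (x ++ (y ++ (Q ++ (z ++ (P ++ v)))))) :
    FlatEq (flatJoin x (y ++ (Q ++ (z ++ (P ++ v))))) (flatJoin x (y ++ (z ++ v))) := by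
  have hp : (x ++ (y ++ (Q ++ (z ++ (P ++ v))))).Perm (P ++ Q ++ (x ++ (y ++ (z ++ v)))) := by
    rw [← Multiset.coe_eq_coe]
    simp only [← Multiset.coe_add]
    abel
  obtain ⟨ha, hb'⟩ := hb.notMem h hp
  set S := shared x (y ++ (Q ++ (z ++ (P ++ v)))) with hS
  have hx : ∀ c ∈ S, c ∈ flatCrossings (x ++ (y ++ (z ++ v))) := fun c h => by
    rw [flatCrossings_append]; exact Finset.mem_union_left _ (Finset.mem_inter.1 h).1
  have haS : a ∉ S := fun h => ha (hx _ h)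
  have hbS : b ∉ S := fun h => hb' (hx _ h)
  have e : flatJoin x (y ++ (z ++ v)) = (x ++ (y ++ (z ++ v)).reverse).map (twist S) := by
    refine map_twist_congr fun c hc => ?_
    have hca : c ≠ a := by
      rintro rfl; exact ha (by simpa only [flatCrossings_append, flatCrossings_reverse] using hc)
    have hcb : c ≠ b := by
      rintro rfl; exact hb' (by simpa only [flatCrossings_append, flatCrossings_reverse] using hc)
    simp only [hS, shared, flatCrossings_append, hb.flatCrossings_left, hb.flatCrossings_right,
      Finset.mem_inter, Finset.mem_union, Finset.mem_insert, Finset.mem_singleton]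
    tauto
  rw [e]
  refine .of_move_rotated (isFlat_flatJoin h) (.r2 a b (P.reverse.map (twist S))
    (Q.reverse.map (twist S)) (z.reverse.map (twist S))
    ((y.reverse ++ (x ++ v.reverse)).map (twist S)) (hb.reverse.twist (by tauto))) ?_ ?_
  · rw [flatJoin, ← hS]
    simp only [← List.map_append]
    refine List.IsRotated.map ?_ _
    simpa using List.isRotated_append (l := x ++ v.reverse)
      (l' := P.reverse ++ (z.reverse ++ (Q.reverse ++ y.reverse)))
  · simp only [← List.map_append]
    refine List.IsRotated.map ?_ _
    simpa using List.isRotated_append (l := z.reverse ++ y.reverse) (l' := x ++ v.reverse)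

/-- The sides of the bigon lie on different paths; its corners are twisted. -/
lemma flatJoin_bigon_split {a b : ℕ} {P Q x y z v : FlatWord} (hb : IsBigon a b P Q)
    (h : IsFlat (x ++ (Q ++ y) ++ (z ++ (P ++ v)))) :
    FlatEq (flatJoin (x ++ (Q ++ y)) (z ++ (P ++ v))) (flatJoin (x ++ y) (z ++ v)) := by
  have hp : (x ++ (Q ++ y) ++ (z ++ (P ++ v))).Perm (P ++ Q ++ (x ++ y ++ (z ++ v))) := by
    rw [← Multiset.coe_eq_coe]
    simp only [← Multiset.coe_add]
    abel
  obtain ⟨ha, hb'⟩ := hb.notMem h hp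
  set S := shared (x ++ (Q ++ y)) (z ++ (P ++ v)) with hS
  have haS : a ∈ S := by
    simp [hS, shared, hb.flatCrossings_left, hb.flatCrossings_right, -mem_flatCrossings]
  have hbS : b ∈ S := by
    simp [hS, shared, hb.flatCrossings_left, hb.flatCrossings_right, -mem_flatCrossings]
  have e : flatJoin (x ++ y) (z ++ v) = (x ++ y ++ (z ++ v).reverse).map (twist S) := by
    refine map_twist_congr fun c hc => ?_
    have hca : c ≠ a := by
      rintro rfl; exact ha (by simpa only [flatCrossings_append, flatCrossings_reverse] using hc)
    have hcb : c ≠ b := by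
      rintro rfl; exact hb' (by simpa only [flatCrossings_append, flatCrossings_reverse] using hc)
    simp only [hS, shared, flatCrossings_append, hb.flatCrossings_left, hb.flatCrossings_right,
      Finset.mem_inter, Finset.mem_union, Finset.mem_insert, Finset.mem_singleton]
    tauto
  rw [e]
  refine .of_move_rotated (isFlat_flatJoin h) (.r2 a b (P.reverse.map (twist S))
    (Q.map (twist S)) ((z.reverse ++ x).map (twist S)) ((y ++ v.reverse).map (twist S))
    ?_) ?_ ?_
  · simpa using (hb.symm.reverse_right.twist (S := S) (by tauto)).symm
  · rw [flatJoin, ← hS]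
    simp only [← List.map_append]
    refine List.IsRotated.map ?_ _
    simpa using List.isRotated_append (l := x ++ (Q ++ (y ++ v.reverse)))
      (l' := P.reverse ++ z.reverse)
  · simp only [← List.map_append]
    refine List.IsRotated.map ?_ _
    simpa using List.isRotated_append (l := z.reverse) (l' := x ++ y ++ v.reverse)

/-- All sides of the triangle lie on the reversed path. -/
lemma flatJoin_triangle_side {a b c : ℕ} {P Q R x y z v u : FlatWord}
    (ht : IsTriangle a b c P Q R)
    (h : IsFlat (x ++ (y ++ (Q ++ (z ++ (R ++ (v ++ (P ++ u)))))))) :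
    FlatEq (flatJoin x (y ++ (Q ++ (z ++ (R ++ (v ++ (P ++ u)))))))
      (flatJoin x (y ++ (Q.reverse ++ (z ++ (R.reverse ++ (v ++ (P.reverse ++ u))))))) := by
  have hp : (x ++ (y ++ (Q ++ (z ++ (R ++ (v ++ (P ++ u))))))).Perm
      (P ++ Q ++ R ++ (x ++ (y ++ (z ++ (v ++ u))))) := by
    rw [← Multiset.coe_eq_coe]
    simp only [← Multiset.coe_add]
    abel
  obtain ⟨ha, hb, hc⟩ := ht.notMem h hp
  set S := shared x (y ++ (Q ++ (z ++ (R ++ (v ++ (P ++ u)))))) with hS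
  have hx : ∀ c ∈ S, c ∈ flatCrossings (x ++ (y ++ (z ++ (v ++ u)))) := fun c h => by
    rw [flatCrossings_append]; exact Finset.mem_union_left _ (Finset.mem_inter.1 h).1
  have hS' : shared x (y ++ (Q.reverse ++ (z ++ (R.reverse ++ (v ++ (P.reverse ++ u)))))) = S := by
    simp only [hS, shared, flatCrossings_append, flatCrossings_reverse]
  refine .of_move_rotated (isFlat_flatJoin h) (.r3 b a c (P.reverse.map (twist S))
    (R.reverse.map (twist S)) (Q.reverse.map (twist S)) (v.reverse.map (twist S))
    (z.reverse.map (twist S)) ((y.reverse ++ (x ++ u.reverse)).map (twist S))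
    (ht.reverse_all (fun h => ha (hx _ h)) (fun h => hb (hx _ h)) (fun h => hc (hx _ h))).swap)
    ?_ ?_
  · rw [flatJoin, ← hS]
    simp only [← List.map_append]
    refine List.IsRotated.map ?_ _
    simpa using List.isRotated_append (l := x ++ u.reverse) (l' := P.reverse ++ (v.reverse ++
      (R.reverse ++ (z.reverse ++ (Q.reverse ++ y.reverse)))))
  · rw [flatJoin, hS']
    simp only [← List.map_append, ← List.map_reverse, List.reverse_reverse]
    refine List.IsRotated.map ?_ _
    simpa using List.isRotated_append (l' := x ++ u.reverse) (l := P ++ (v.reverse ++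
      (R ++ (z.reverse ++ (Q ++ y.reverse)))))

/-- One side of the triangle lies on the path that keeps its orientation. The remaining
distributions of the sides follow by cyclic permutation and by exchanging the two paths. -/
lemma flatJoin_triangle_split {a b c : ℕ} {P Q R x y z v u : FlatWord}
    (ht : IsTriangle a b c P Q R)
    (h : IsFlat (x ++ (Q ++ y) ++ (z ++ (R ++ (v ++ (P ++ u)))))) :
    FlatEq (flatJoin (x ++ (Q ++ y)) (z ++ (R ++ (v ++ (P ++ u)))))
      (flatJoin (x ++ (Q.reverse ++ y)) (z ++ (R.reverse ++ (v ++ (P.reverse ++ u))))) := by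
  have hp : (x ++ (Q ++ y) ++ (z ++ (R ++ (v ++ (P ++ u))))).Perm
      (P ++ Q ++ R ++ (x ++ (y ++ (z ++ (v ++ u))))) := by
    rw [← Multiset.coe_eq_coe]
    simp only [← Multiset.coe_add]
    abel
  have hp' : (x ++ (Q ++ y) ++ (z ++ (R ++ (v ++ (P ++ u))))).Perm
      (Q ++ R ++ P ++ (x ++ (y ++ (z ++ (v ++ u))))) := by
    rw [← Multiset.coe_eq_coe]
    simp only [← Multiset.coe_add]
    abel
  have hp'' : (x ++ (Q ++ y) ++ (z ++ (R ++ (v ++ (P ++ u))))).Perm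
      (R ++ P ++ Q ++ (x ++ (y ++ (z ++ (v ++ u))))) := by
    rw [← Multiset.coe_eq_coe]
    simp only [← Multiset.coe_add]
    abel
  obtain ⟨ha, hb, hc⟩ := ht.notMem h hp
  have hab := ht.ne h hp
  have hca := ht.rotate.ne h hp'
  have hbc := ht.rotate.rotate.ne h hp''
  set S := shared (x ++ (Q ++ y)) (z ++ (R ++ (v ++ (P ++ u)))) with hS
  have hS' : shared (x ++ (Q.reverse ++ y))
      (z ++ (R.reverse ++ (v ++ (P.reverse ++ u)))) = S := by
    simp only [hS, shared, flatCrossings_append, flatCrossings_reverse]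
  have haS : a ∈ S := by
    simp [hS, shared, ht.flatCrossings_left, ht.flatCrossings_middle, -mem_flatCrossings]
  have hcS : c ∈ S := by
    simp [hS, shared, ht.flatCrossings_right, ht.flatCrossings_middle, -mem_flatCrossings]
  have hbS : b ∉ S := by
    simp only [flatCrossings_append, Finset.mem_union, not_or] at hb
    simp only [hS, shared, flatCrossings_append, ht.flatCrossings_middle, Finset.mem_inter,
      Finset.mem_union, Finset.mem_insert, Finset.mem_singleton]
    tauto
  have ht' : IsTriangle a c b (Q.map (twist S)) (P.reverse.map (twist S))
      (R.reverse.map (twist S)) := by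
    simpa [← List.map_reverse] using (ht.rotate.reverse_one hcS haS hbS).reverse.swap
  refine .of_move_rotated (isFlat_flatJoin h) (.r3 a c b (Q.map (twist S))
    (P.reverse.map (twist S)) (R.reverse.map (twist S)) ((y ++ u.reverse).map (twist S))
    (v.reverse.map (twist S)) ((z.reverse ++ x).map (twist S)) ht') ?_ ?_
  · rw [flatJoin, ← hS]
    simp only [← List.map_append]
    refine List.IsRotated.map ?_ _
    simpa using List.isRotated_append (l := x) (l' := Q ++ (y ++ (u.reverse ++ (P.reverse ++
      (v.reverse ++ (R.reverse ++ z.reverse))))))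
  · rw [flatJoin, hS']
    simp only [← List.map_append, ← List.map_reverse, List.reverse_reverse]
    refine List.IsRotated.map ?_ _
    simpa using List.isRotated_append (l' := x) (l := Q.reverse ++ (y ++ (u.reverse ++ (P ++
      (v.reverse ++ (R ++ z.reverse))))))

/-- The crossing `c` of `w` and the crossing `c'` of `w'` have the same index and, up to
equivalence, the same smoothing. -/
def SameCrossing (w : FlatWord) (c : ℕ) (w' : FlatWord) (c' : ℕ) : Prop :=
  flatIndex w c = flatIndex w' c' ∧ FlatEq (flatSmooth w c) (flatSmooth w' c')

lemma SameCrossing.symm {w w' : FlatWord} {c c' : ℕ} (h : SameCrossing w c w' c') :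
    SameCrossing w' c' w c := ⟨h.1.symm, h.2.symm⟩

lemma SameCrossing.of_isCut {w w' : FlatWord} {c c' : ℕ} {x y x' y' : FlatWord} (hw : IsFlat w)
    (hw' : IsFlat w') (h : IsCut w c x y) (h' : IsCut w' c' x' y') (hs : steps x = steps x')
    (hj : FlatEq (flatJoin x y) (flatJoin x' y')) : SameCrossing w c w' c' :=
  ⟨by rw [h.flatIndex_eq hw, h'.flatIndex_eq hw', hs],
    by rwa [h.flatSmooth_eq hw, h'.flatSmooth_eq hw']⟩

lemma isCut_neg {w : FlatWord} {c : ℕ} {x y : FlatWord}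
    (h : w ~r (c, -1) :: (x ++ (c, 1) :: y)) : IsCut w c y x := by
  refine h.trans ?_
  simpa using List.isRotated_append (l := (c, -1) :: x) (l' := (c, 1) :: y)

lemma flatEq_flatJoin_swap {x y x' y' : FlatWord} (h : FlatEq (flatJoin x y) (flatJoin x' y')) :
    FlatEq (flatJoin y x) (flatJoin y' x') := by
  simpa only [flatJoin_reverse] using h.reverse

/-- The comparison may be made for the paths that start at either passage of the crossing, since
exchanging the paths negates the total step and reverses the smoothing. -/
lemma SameCrossing.of_rotated {w w' : FlatWord} {c c' : ℕ} {s : ℤˣ} {x y x' y' : FlatWord}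
    (hw : IsFlat w) (hw' : IsFlat w') (h : w ~r (c, s) :: (x ++ (c, -s) :: y))
    (h' : w' ~r (c', s) :: (x' ++ (c', -s) :: y')) (hs : steps x = steps x')
    (hj : FlatEq (flatJoin x y) (flatJoin x' y')) : SameCrossing w c w' c' := by
  rcases Int.units_eq_one_or s with rfl | rfl
  · exact .of_isCut hw hw' h h' hs hj
  · rw [neg_neg] at h h'
    have h1 := isCut_neg h
    have h2 := isCut_neg h'
    refine .of_isCut hw hw' h1 h2 ?_ (flatEq_flatJoin_swap hj)
    have := h1.steps_add hw
    have := h2.steps_add hw'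
    linarith

lemma SameCrossing.rotate {w w' : FlatWord} (hw : IsFlat w) (h : w ~r w') {c : ℕ}
    (hc : c ∈ flatCrossings w) : SameCrossing w c w' c := by
  obtain ⟨x, y, hx⟩ := exists_isCut hw hc
  exact .of_isCut hw (hw.perm h.perm) hx (h.symm.trans hx) rfl (.refl _)

lemma map_relabel_flatJoin {f : ℕ → ℕ} (hf : Function.Injective f) (x y : FlatWord) :
    (flatJoin x y).map (fun p => (f p.1, p.2)) =
      flatJoin (x.map fun p => (f p.1, p.2)) (y.map fun p => (f p.1, p.2)) := by
  have : ∀ v : FlatWord, ∀ c, f c ∈ flatCrossings (v.map fun p => (f p.1, p.2)) ↔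
      c ∈ flatCrossings v := fun v c => by
    simp [flatCrossings, hf.eq_iff]
  rw [flatJoin, flatJoin, ← List.map_reverse, ← List.map_append, List.map_map, List.map_map]
  refine List.map_congr_left fun p _ => ?_
  have h2 : f p.1 ∈ shared (x.map fun p => (f p.1, p.2)) (y.map fun p => (f p.1, p.2)) ↔
      p.1 ∈ shared x y := by
    rw [shared, shared, Finset.mem_inter, Finset.mem_inter, this, this]
  by_cases h : p.1 ∈ shared x y <;> simp [twist, h, h2]

lemma SameCrossing.relabel {w : FlatWord} (hw : IsFlat w) {f : ℕ → ℕ}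
    (hf : Function.Injective f) {c : ℕ} (hc : c ∈ flatCrossings w) :
    SameCrossing w c (w.map fun p => (f p.1, p.2)) (f c) := by
  obtain ⟨x, y, hx⟩ := exists_isCut hw hc
  refine .of_isCut (x' := x.map fun p => (f p.1, p.2)) (y' := y.map fun p => (f p.1, p.2)) hw
    (hw.map_relabel hf) hx ?_ ?_ ?_
  · have := List.IsRotated.map hx (fun p => (f p.1, p.2))
    simpa [IsCut] using this
  · simp [steps, Function.comp_def]
  · rw [← map_relabel_flatJoin hf]
    exact .of_move (isFlat_flatJoin (hx.isFlat hw)) (.relabel f hf _)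

/-! ### Crossings that survive a move -/

lemma sameCrossing_kink_aux {a c : ℕ} {s : ℤˣ} {w w' A B : FlatWord} (hw : IsFlat w)
    (hw' : IsFlat w') (h : w ~r (c, 1) :: (B ++ ((a, s) :: (a, -s) :: A)))
    (h' : w' ~r (c, 1) :: (B ++ A)) : SameCrossing w c w' c := by
  have hm : (c, (-1 : ℤˣ)) ∈ B ∨ (c, (-1 : ℤˣ)) ∈ A := by
    have := h'.mem_iff.1 (mem_both_of_mem hw' (c := c) (by
      exact mem_flatCrossings.2 ⟨1, h'.mem_iff.2 (by simp)⟩) (-1))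
    simpa using this
  rcases hm with hm | hm
  · obtain ⟨B, B', rfl⟩ := List.append_of_mem hm
    have k : IsCut w c B (B' ++ ((a, s) :: (a, -s) :: A)) := by simpa [IsCut] using h
    have k' : IsCut w' c B (B' ++ A) := by simpa [IsCut] using h'
    exact .of_isCut hw hw' k k' rfl (flatJoin_kink (k.isFlat hw))
  · obtain ⟨A, A', rfl⟩ := List.append_of_mem hm
    have k : IsCut w c (B ++ ((a, s) :: (a, -s) :: A)) A' := by simpa [IsCut] using h
    have k' : IsCut w' c (B ++ A) A' := by simpa [IsCut] using h'
    exact .of_isCut hw hw' k k' (by simp) (flatEq_flatJoin_swap (flatJoin_kink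
      ((k.isFlat hw).perm List.perm_append_comm)))

lemma sameCrossing_kink {a c : ℕ} {s : ℤˣ} {v : FlatWord} (hw : IsFlat ((a, s) :: (a, -s) :: v))
    (hc : c ∈ flatCrossings v) : SameCrossing ((a, s) :: (a, -s) :: v) c v c := by
  have hv := hw.of_move (.r1 a s v)
  obtain ⟨A, B, rfl⟩ := List.append_of_mem (mem_both_of_mem hv hc 1)
  refine sameCrossing_kink_aux (a := a) (s := s) (A := A) (B := B) hw hv ?_ ?_
  · simpa using List.isRotated_append (l := (a, s) :: (a, -s) :: A) (l' := (c, 1) :: B)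
  · simpa using List.isRotated_append (l := A) (l' := (c, 1) :: B)

lemma sameCrossing_bigon_aux {a b c : ℕ} {P Q w w' A B y : FlatWord} (hb : IsBigon a b P Q)
    (hw : IsFlat w) (hw' : IsFlat w') (h : w ~r (c, 1) :: (B ++ (Q ++ (y ++ (P ++ A)))))
    (h' : w' ~r (c, 1) :: (B ++ (y ++ A))) : SameCrossing w c w' c := by
  have hm : (c, (-1 : ℤˣ)) ∈ B ∨ (c, (-1 : ℤˣ)) ∈ y ∨ (c, (-1 : ℤˣ)) ∈ A := by
    have := h'.mem_iff.1 (mem_both_of_mem hw' (c := c) (by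
      exact mem_flatCrossings.2 ⟨1, h'.mem_iff.2 (by simp)⟩) (-1))
    simpa using this
  rcases hm with hm | hm | hm
  · obtain ⟨B, B', rfl⟩ := List.append_of_mem hm
    have k : IsCut w c B (B' ++ (Q ++ (y ++ (P ++ A)))) := by simpa [IsCut] using h
    have k' : IsCut w' c B (B' ++ (y ++ A)) := by simpa [IsCut] using h'
    exact .of_isCut hw hw' k k' rfl (flatJoin_bigon_side hb (k.isFlat hw))
  · obtain ⟨y, y', rfl⟩ := List.append_of_mem hm
    have k : IsCut w c (B ++ (Q ++ y)) (y' ++ (P ++ A)) := by simpa [IsCut] using h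
    have k' : IsCut w' c (B ++ y) (y' ++ A) := by simpa [IsCut] using h'
    exact .of_isCut hw hw' k k' (by simp [hb.steps_right]) (flatJoin_bigon_split hb (k.isFlat hw))
  · obtain ⟨A, A', rfl⟩ := List.append_of_mem hm
    have k : IsCut w c (B ++ (Q ++ (y ++ (P ++ A)))) A' := by simpa [IsCut] using h
    have k' : IsCut w' c (B ++ (y ++ A)) A' := by simpa [IsCut] using h'
    exact .of_isCut hw hw' k k' (by simp [hb.steps_right, hb.steps_left])
      (flatEq_flatJoin_swap (flatJoin_bigon_side hb
        ((k.isFlat hw).perm List.perm_append_comm)))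

lemma sameCrossing_bigon {a b c : ℕ} {P Q x y : FlatWord} (hb : IsBigon a b P Q)
    (hw : IsFlat (P ++ (x ++ (Q ++ y)))) (hc : c ∈ flatCrossings (x ++ y)) :
    SameCrossing (P ++ (x ++ (Q ++ y))) c (x ++ y) c := by
  have hv := hw.of_move (.r2 a b P Q x y hb)
  rcases List.mem_append.1 (mem_both_of_mem hv hc 1) with h | h
  · obtain ⟨A, B, rfl⟩ := List.append_of_mem h
    refine sameCrossing_bigon_aux (A := A) (B := B) (y := y) hb hw hv ?_ ?_
    · simpa using List.isRotated_append (l := P ++ A) (l' := (c, 1) :: B ++ (Q ++ y))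
    · simpa using List.isRotated_append (l := A) (l' := (c, 1) :: B ++ y)
  · obtain ⟨A, B, rfl⟩ := List.append_of_mem h
    refine sameCrossing_bigon_aux (A := A) (B := B) (y := x) hb.symm hw hv ?_ ?_
    · simpa using List.isRotated_append (l := P ++ (x ++ (Q ++ A))) (l' := (c, 1) :: B)
    · simpa using List.isRotated_append (l := x ++ A) (l' := (c, 1) :: B)

lemma sameCrossing_triangle_aux {a b c d : ℕ} {P Q R w w' A B y z : FlatWord}
    (ht : IsTriangle a b c P Q R) (hw : IsFlat w) (hw' : IsFlat w') (hd : d ≠ a ∧ d ≠ b ∧ d ≠ c)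
    (h : w ~r (d, 1) :: (B ++ (Q ++ (y ++ (R ++ (z ++ (P ++ A)))))))
    (h' : w' ~r (d, 1) :: (B ++ (Q.reverse ++ (y ++ (R.reverse ++ (z ++ (P.reverse ++ A))))))) :
    SameCrossing w d w' d := by
  have hQ : ∀ s, (d, s) ∉ Q := fun s h => by
    have : d ∈ flatCrossings Q := mem_flatCrossings.2 ⟨s, h⟩
    simp [ht.flatCrossings_middle, -mem_flatCrossings, hd] at this
  have hP : ∀ s, (d, s) ∉ P := fun s h => by
    have : d ∈ flatCrossings P := mem_flatCrossings.2 ⟨s, h⟩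
    simp [ht.flatCrossings_left, -mem_flatCrossings, hd] at this
  have hR : ∀ s, (d, s) ∉ R := fun s h => by
    have : d ∈ flatCrossings R := mem_flatCrossings.2 ⟨s, h⟩
    simp [ht.flatCrossings_right, -mem_flatCrossings, hd] at this
  have hm : (d, (-1 : ℤˣ)) ∈ B ∨ (d, (-1 : ℤˣ)) ∈ y ∨ (d, (-1 : ℤˣ)) ∈ z ∨
      (d, (-1 : ℤˣ)) ∈ A := by
    have := h'.mem_iff.1 (mem_both_of_mem hw' (c := d) (by
      exact mem_flatCrossings.2 ⟨1, h'.mem_iff.2 (by simp)⟩) (-1))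
    simpa [hP, hQ, hR] using this
  rcases hm with hm | hm | hm | hm
  · obtain ⟨B, B', rfl⟩ := List.append_of_mem hm
    have k : IsCut w d B (B' ++ (Q ++ (y ++ (R ++ (z ++ (P ++ A)))))) := by
      simpa [IsCut] using h
    have k' : IsCut w' d B (B' ++ (Q.reverse ++ (y ++ (R.reverse ++ (z ++ (P.reverse ++ A)))))) := by
      simpa [IsCut] using h'
    exact .of_isCut hw hw' k k' rfl (flatJoin_triangle_side ht (k.isFlat hw))
  · obtain ⟨y, y', rfl⟩ := List.append_of_mem hm
    have k : IsCut w d (B ++ (Q ++ y)) (y' ++ (R ++ (z ++ (P ++ A)))) := by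
      simpa [IsCut] using h
    have k' : IsCut w' d (B ++ (Q.reverse ++ y))
        (y' ++ (R.reverse ++ (z ++ (P.reverse ++ A)))) := by simpa [IsCut] using h'
    exact .of_isCut hw hw' k k' (by simp) (flatJoin_triangle_split ht (k.isFlat hw))
  · obtain ⟨z, z', rfl⟩ := List.append_of_mem hm
    have k : IsCut w d (B ++ (Q ++ (y ++ (R ++ z)))) (z' ++ (P ++ A)) := by
      simpa [IsCut] using h
    have k' : IsCut w' d (B ++ (Q.reverse ++ (y ++ (R.reverse ++ z))))
        (z' ++ (P.reverse ++ A)) := by simpa [IsCut] using h'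
    exact .of_isCut hw hw' k k' (by simp) (flatEq_flatJoin_swap (flatJoin_triangle_split
      ht.rotate.rotate ((k.isFlat hw).perm List.perm_append_comm)))
  · obtain ⟨A, A', rfl⟩ := List.append_of_mem hm
    have k : IsCut w d (B ++ (Q ++ (y ++ (R ++ (z ++ (P ++ A)))))) A' := by
      simpa [IsCut] using h
    have k' : IsCut w' d (B ++ (Q.reverse ++ (y ++ (R.reverse ++ (z ++ (P.reverse ++ A)))))) A' := by
      simpa [IsCut] using h'
    exact .of_isCut hw hw' k k' (by simp) (flatEq_flatJoin_swap (flatJoin_triangle_side ht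
      ((k.isFlat hw).perm List.perm_append_comm)))

lemma sameCrossing_triangle {a b c d : ℕ} {P Q R x y z : FlatWord}
    (ht : IsTriangle a b c P Q R) (hw : IsFlat (P ++ (x ++ (Q ++ (y ++ (R ++ z))))))
    (hd : d ∈ flatCrossings (x ++ (y ++ z))) :
    SameCrossing (P ++ (x ++ (Q ++ (y ++ (R ++ z))))) d
      (P.reverse ++ (x ++ (Q.reverse ++ (y ++ (R.reverse ++ z))))) d := by
  have hw' := hw.of_move (.r3 a b c P Q R x y z ht)
  have hn := ht.notMem hw (perm_triangle_front P Q R x y z)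
  have hd' : d ≠ a ∧ d ≠ b ∧ d ≠ c := by
    refine ⟨?_, ?_, ?_⟩ <;> rintro rfl
    exacts [hn.1 hd, hn.2.1 hd, hn.2.2 hd]
  have hx : (d, (1 : ℤˣ)) ∈ x ++ (y ++ z) := by
    have hm := mem_both_of_mem (c := d) hw (by
      simp only [flatCrossings_append, Finset.mem_union] at hd ⊢; tauto) 1
    have hm' := (perm_triangle_front P Q R x y z).mem_iff.1 hm
    rcases List.mem_append.1 hm' with h | h
    · have : d ∈ flatCrossings (P ++ Q ++ R) := mem_flatCrossings.2 ⟨1, h⟩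
      simp [ht.flatCrossings_left, ht.flatCrossings_middle, ht.flatCrossings_right,
        -mem_flatCrossings, hd'] at this
    · exact h
  simp only [List.mem_append] at hx
  rcases hx with h | h | h
  · obtain ⟨A, B, rfl⟩ := List.append_of_mem h
    refine sameCrossing_triangle_aux (A := A) (B := B) (y := y) (z := z) ht hw hw' hd' ?_ ?_
    · simpa using List.isRotated_append (l := P ++ A) (l' := (d, 1) :: B ++ (Q ++ (y ++ (R ++ z))))
    · simpa using List.isRotated_append (l := P.reverse ++ A)
        (l' := (d, 1) :: B ++ (Q.reverse ++ (y ++ (R.reverse ++ z))))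
  · obtain ⟨A, B, rfl⟩ := List.append_of_mem h
    refine sameCrossing_triangle_aux (A := A) (B := B) (y := z) (z := x) ht.rotate hw hw'
      ⟨hd'.2.2, hd'.1, hd'.2.1⟩ ?_ ?_
    · simpa using List.isRotated_append (l := P ++ (x ++ (Q ++ A))) (l' := (d, 1) :: B ++ (R ++ z))
    · simpa using List.isRotated_append (l := P.reverse ++ (x ++ (Q.reverse ++ A)))
        (l' := (d, 1) :: B ++ (R.reverse ++ z))
  · obtain ⟨A, B, rfl⟩ := List.append_of_mem h
    refine sameCrossing_triangle_aux (A := A) (B := B) (y := x) (z := y) ht.rotate.rotate hw hw'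
      ⟨hd'.2.1, hd'.2.2, hd'.1⟩ ?_ ?_
    · simpa using List.isRotated_append (l := P ++ (x ++ (Q ++ (y ++ (R ++ A)))))
        (l' := (d, 1) :: B)
    · simpa using List.isRotated_append
        (l := P.reverse ++ (x ++ (Q.reverse ++ (y ++ (R.reverse ++ A))))) (l' := (d, 1) :: B)

/-! ### Crossings that disappear in a move -/

lemma flatJoin_nil_left (v : FlatWord) : flatJoin [] v = v.reverse := by
  rw [flatJoin, List.nil_append]
  exact map_twist_eq_self fun c _ => by simp [shared]

lemma flatJoin_nil_right (v : FlatWord) : flatJoin v [] = v := by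
  rw [← flatJoin_reverse, flatJoin_nil_left, List.reverse_reverse]

lemma flatIndex_kink {a : ℕ} {s : ℤˣ} {v : FlatWord} (hw : IsFlat ((a, s) :: (a, -s) :: v)) :
    flatIndex ((a, s) :: (a, -s) :: v) a = 0 := by
  rcases Int.units_eq_one_or s with rfl | rfl
  · have k : IsCut ((a, 1) :: (a, -1) :: v) a [] v := List.IsRotated.refl _
    rw [k.flatIndex_eq hw, steps_nil]
  · have k : IsCut ((a, -1) :: (a, 1) :: v) a v [] := isCut_neg (List.IsRotated.refl _)
    have hv := hw.of_move (.r1 a (-1) v)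
    rw [neg_neg] at hw ⊢
    rw [k.flatIndex_eq hw, hv.steps_eq_zero]

lemma flatSmooth_kink {a : ℕ} {v : FlatWord} {s : ℤˣ} (hw : IsFlat ((a, s) :: (a, -s) :: v)) :
    flatSmooth ((a, s) :: (a, -s) :: v) a = if s = 1 then v.reverse else v := by
  rcases Int.units_eq_one_or s with rfl | rfl
  · have k : IsCut ((a, 1) :: (a, -1) :: v) a [] v := List.IsRotated.refl _
    rw [k.flatSmooth_eq hw, flatJoin_nil_left]; simp
  · have k : IsCut ((a, -1) :: (a, 1) :: v) a v [] := isCut_neg (List.IsRotated.refl _)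
    rw [neg_neg] at hw ⊢
    rw [k.flatSmooth_eq hw, flatJoin_nil_right]; simp

/-- The crossings `a` and `b` of `w` have opposite indices and, up to equivalence, smoothings that
are reverses of each other. -/
def OppositeCrossings (w : FlatWord) (a b : ℕ) : Prop :=
  flatIndex w a = -flatIndex w b ∧ FlatEq (flatSmooth w a) (flatSmooth w b).reverse

/-- It suffices to compare the paths that start at passages of opposite steps. -/
lemma OppositeCrossings.of_rotated {w : FlatWord} {a b : ℕ} {s : ℤˣ} {x y x' y' : FlatWord}
    (hw : IsFlat w) (h : w ~r (a, s) :: (x ++ (a, -s) :: y))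
    (h' : w ~r (b, -s) :: (x' ++ (b, s) :: y')) (hs : steps x = steps x')
    (hj : FlatEq (flatJoin x y) (flatJoin x' y')) : OppositeCrossings w a b := by
  rcases Int.units_eq_one_or s with rfl | rfl
  · have h2 := isCut_neg h'
    refine ⟨?_, ?_⟩
    · have := h2.steps_add hw
      rw [IsCut.flatIndex_eq hw h, h2.flatIndex_eq hw]; linarith
    · rw [IsCut.flatSmooth_eq hw h, h2.flatSmooth_eq hw, flatJoin_reverse]; exact hj
  · rw [neg_neg] at h h'
    have h1 := isCut_neg h
    refine ⟨?_, ?_⟩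
    · have := h1.steps_add hw
      rw [IsCut.flatIndex_eq hw h', h1.flatIndex_eq hw]; linarith
    · rw [IsCut.flatSmooth_eq hw h', h1.flatSmooth_eq hw, flatJoin_reverse]
      exact flatEq_flatJoin_swap hj

lemma shared_congr_of_notMem {a : ℕ} {x y x' y' : FlatWord}
    (hx : ∀ c, c ≠ a → (c ∈ flatCrossings x' ↔ c ∈ flatCrossings x))
    (hy : ∀ c, c ≠ a → (c ∈ flatCrossings y' ↔ c ∈ flatCrossings y)) {v : FlatWord}
    (hv : a ∉ flatCrossings v) : v.map (twist (shared x y)) = v.map (twist (shared x' y')) := by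
  refine map_twist_congr fun c hc => ?_
  have : c ≠ a := by rintro rfl; exact hv hc
  rw [shared, shared, Finset.mem_inter, Finset.mem_inter, hx c this, hy c this]

lemma flatJoin_cons_cons {b : ℕ} {s : ℤˣ} {x y : FlatWord}
    (h : IsFlat ((b, s) :: x ++ (b, -s) :: y)) :
    FlatEq (flatJoin ((b, s) :: x) ((b, -s) :: y)) (flatJoin x y) := by
  have hb : b ∉ flatCrossings (x ++ y.reverse) := by
    have := notMem_kink (a := b) (s := s) (v := x ++ y) h (by
      rw [← Multiset.coe_eq_coe]
      simp only [← Multiset.coe_add, ← Multiset.cons_coe, Multiset.add_cons, Multiset.cons_add,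
        Multiset.cons_swap])
    simpa only [flatCrossings_append, flatCrossings_reverse] using this
  have hS : b ∈ shared ((b, s) :: x) ((b, -s) :: y) := by simp [shared, -mem_flatCrossings]
  refine .of_move_rotated (isFlat_flatJoin h) (.r1 b s (flatJoin x y)) ?_ (.refl _)
  have e : flatJoin x y = (x ++ y.reverse).map (twist (shared ((b, s) :: x) ((b, -s) :: y))) :=
    shared_congr_of_notMem (a := b) (by simp +contextual [-mem_flatCrossings])
      (by simp +contextual [-mem_flatCrossings]) hb
  rw [e, flatJoin]
  have := List.isRotated_append (l := ((b, s) :: (x ++ y.reverse)).map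
    (twist (shared ((b, s) :: x) ((b, -s) :: y)))) (l' := [(b, s)])
  simpa [twist_mem hS] using this

lemma flatJoin_concat_concat {b : ℕ} {s : ℤˣ} {x y : FlatWord}
    (h : IsFlat ((x ++ [(b, s)]) ++ (y ++ [(b, -s)]))) :
    FlatEq (flatJoin (x ++ [(b, s)]) (y ++ [(b, -s)])) (flatJoin x y) := by
  have hb : b ∉ flatCrossings (x ++ y.reverse) := by
    have := notMem_kink (a := b) (s := s) (v := x ++ y) h (by
      rw [← Multiset.coe_eq_coe]
      simp only [← Multiset.coe_add, ← Multiset.cons_coe, Multiset.add_cons, Multiset.cons_add,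
        Multiset.cons_swap, Multiset.coe_nil, add_zero])
    simpa only [flatCrossings_append, flatCrossings_reverse] using this
  have hS : b ∈ shared (x ++ [(b, s)]) (y ++ [(b, -s)]) := by simp [shared, -mem_flatCrossings]
  set S := shared (x ++ [(b, s)]) (y ++ [(b, -s)]) with hSdef
  have e : flatJoin x y = (x ++ y.reverse).map (twist S) :=
    shared_congr_of_notMem (a := b) (by simp +contextual [-mem_flatCrossings])
      (by simp +contextual [-mem_flatCrossings]) hb
  refine .of_move_rotated (isFlat_flatJoin h) (.r1 b (-s) ((y.reverse ++ x).map (twist S))) ?_ ?_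
  · rw [flatJoin, ← hSdef]
    simpa [twist_mem hS] using List.isRotated_append (l := x.map (twist S))
      (l' := (b, -s) :: (b, s) :: y.reverse.map (twist S))
  · rw [e]
    exact List.IsRotated.map List.isRotated_append _

lemma map_relabel_eq_self {f : ℕ → ℕ} {v : FlatWord} (h : ∀ c ∈ flatCrossings v, f c = c) :
    v.map (fun p => (f p.1, p.2)) = v := by
  refine (List.map_congr_left fun p hp => ?_).trans (List.map_id v)
  simp [h p.1 (mem_flatCrossings.2 ⟨p.2, hp⟩)]

/-- A crossing `b` whose passages bound the path `x` and a crossing `a` whose passages bound the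
path `y` give the same curve: in both cases the crossing separates `x` from `y` reversed. -/
lemma flatJoin_enclose {a b : ℕ} {s : ℤˣ} {x y : FlatWord}
    (h : IsFlat ((b, s) :: (x ++ [(b, -s)]) ++ y)) (ha : a ∉ flatCrossings (x ++ y)) :
    FlatEq (flatJoin ((b, s) :: (x ++ [(b, -s)])) y)
      (flatJoin x ((a, s) :: (y ++ [(a, -s)]))) := by
  have hb : b ∉ flatCrossings (x ++ y) := notMem_kink (a := b) (s := s) (v := x ++ y) h (by
      rw [← Multiset.coe_eq_coe]
      simp only [← Multiset.coe_add, ← Multiset.cons_coe, Multiset.add_cons, Multiset.cons_add,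
        Multiset.coe_nil, add_zero])
  simp only [flatCrossings_append, Finset.mem_union, not_or] at ha hb
  have hSb : b ∉ shared ((b, s) :: (x ++ [(b, -s)])) y := fun h => hb.2 (Finset.mem_inter.1 h).2
  have hSa : a ∉ shared x ((a, s) :: (y ++ [(a, -s)])) := fun h => ha.1 (Finset.mem_inter.1 h).1
  have e1 : ∀ v, b ∉ flatCrossings v → v.map (twist (shared ((b, s) :: (x ++ [(b, -s)])) y)) =
      v.map (twist (shared x y)) := fun v hv =>
    (shared_congr_of_notMem (a := b) (by simp +contextual [-mem_flatCrossings])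
      (by simp +contextual [-mem_flatCrossings]) hv).symm
  have e2 : ∀ v, a ∉ flatCrossings v → v.map (twist (shared x ((a, s) :: (y ++ [(a, -s)])))) =
      v.map (twist (shared x y)) := fun v hv =>
    (shared_congr_of_notMem (a := a) (by simp +contextual [-mem_flatCrossings])
      (by simp +contextual [-mem_flatCrossings]) hv).symm
  refine .of_move_rotated (isFlat_flatJoin h) (.relabel (Equiv.swap a b)
    (Equiv.swap a b).injective _) (.refl _) ?_
  have h1 : ∀ v, a ∉ flatCrossings v → b ∉ flatCrossings v →
      (v.map (twist (shared x y))).map (fun p => (Equiv.swap a b p.1, p.2)) =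
        v.map (twist (shared x y)) := fun v hva hvb => by
    refine map_relabel_eq_self fun c hc => ?_
    rw [flatCrossings_map_twist] at hc
    refine Equiv.swap_apply_of_ne_of_ne ?_ ?_ <;> rintro rfl <;> contradiction
  rw [flatJoin, flatJoin]
  simp only [List.map_append, List.map_cons, List.cons_append, List.reverse_cons,
    List.reverse_append, List.map_nil, List.reverse_nil, List.nil_append, twist_notMem hSb,
    twist_notMem hSa]
  rw [e1 x hb.1, e2 x ha.1, e1 y.reverse (by simpa only [flatCrossings_reverse] using hb.2),
    e2 y.reverse (by simpa only [flatCrossings_reverse] using ha.2), h1 x ha.1 hb.1,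
    h1 y.reverse (by simpa only [flatCrossings_reverse] using ha.2)
      (by simpa only [flatCrossings_reverse] using hb.2)]
  simpa using List.isRotated_append (l := [(a, s)])
    (l' := x.map (twist (shared x y)) ++ (a, -s) :: y.reverse.map (twist (shared x y)))

lemma isFlat_of_isRotated_cut {w : FlatWord} (hw : IsFlat w) {c : ℕ} {s : ℤˣ} {x y : FlatWord}
    (h : w ~r (c, s) :: (x ++ (c, -s) :: y)) : IsFlat (x ++ y) := by
  refine (hw.perm (w := [(c, s), (c, -s)] ++ (x ++ y)) (h.perm.trans ?_)).of_append_right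
    (isFlat_pair c s)
  simp

/-- Smoothing one corner of a bigon turns the other one into a kink or into a crossing that
separates the two paths; in either case the two smoothings agree after a reversal. -/
lemma bigon_crossings {a b : ℕ} {P Q x y : FlatWord} (hb : IsBigon a b P Q)
    (hw : IsFlat (P ++ (x ++ (Q ++ y)))) :
    OppositeCrossings (P ++ (x ++ (Q ++ y))) a b := by
  obtain ⟨ha, hb'⟩ := hb.notMem hw (perm_bigon P Q x y)
  obtain ⟨s, rfl | rfl, rfl | rfl⟩ := hb
  · have k : [(a, s), (b, -s)] ++ (x ++ ([(a, -s), (b, s)] ++ y)) ~r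
        (a, s) :: ((b, -s) :: x ++ (a, -s) :: ((b, s) :: y)) := by simp [List.IsRotated.refl]
    have k' : [(a, s), (b, -s)] ++ (x ++ ([(a, -s), (b, s)] ++ y)) ~r
        (b, -s) :: (x ++ [(a, -s)] ++ (b, s) :: (y ++ [(a, s)])) := by
      simpa using List.isRotated_append (l := [(a, s)])
        (l' := (b, -s) :: (x ++ (a, -s) :: (b, s) :: y))
    refine .of_rotated hw k k' (by simp [add_comm]) ?_
    have f := isFlat_of_isRotated_cut hw k
    have f' := isFlat_of_isRotated_cut (s := -s) hw (by rw [neg_neg]; exact k')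
    have := flatJoin_cons_cons (s := -s) (by rw [neg_neg]; exact f)
    have h2 := flatJoin_concat_concat (s := -s) (by rw [neg_neg]; exact f')
    rw [neg_neg] at this h2
    exact this.trans h2.symm
  · have k : [(a, s), (b, -s)] ++ (x ++ ([(b, s), (a, -s)] ++ y)) ~r
        (a, s) :: ((b, -s) :: (x ++ [(b, s)]) ++ (a, -s) :: y) := by simp [List.IsRotated.refl]
    have k' : [(a, s), (b, -s)] ++ (x ++ ([(b, s), (a, -s)] ++ y)) ~r
        (b, -s) :: (x ++ (b, s) :: ((a, -s) :: (y ++ [(a, s)]))) := by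
      simpa using List.isRotated_append (l := [(a, s)])
        (l' := (b, -s) :: (x ++ (b, s) :: (a, -s) :: y))
    refine .of_rotated hw k k' (by simp) ?_
    have f := isFlat_of_isRotated_cut hw k
    have := flatJoin_enclose (s := -s) (a := a) (by rw [neg_neg]; exact f) ha
    rwa [neg_neg] at this
  · have k : [(b, -s), (a, s)] ++ (x ++ ([(a, -s), (b, s)] ++ y)) ~r
        (a, s) :: (x ++ (a, -s) :: ((b, s) :: (y ++ [(b, -s)]))) := by
      simpa using List.isRotated_append (l := [(b, -s)])
        (l' := (a, s) :: (x ++ (a, -s) :: (b, s) :: y))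
    have k' : [(b, -s), (a, s)] ++ (x ++ ([(a, -s), (b, s)] ++ y)) ~r
        (b, -s) :: ((a, s) :: (x ++ [(a, -s)]) ++ (b, s) :: y) := by simp [List.IsRotated.refl]
    refine .of_rotated hw k k' (by simp) ?_
    have f' := isFlat_of_isRotated_cut (s := -s) hw (by rw [neg_neg]; exact k')
    exact (flatJoin_enclose f' hb').symm
  · have k : [(b, -s), (a, s)] ++ (x ++ ([(b, s), (a, -s)] ++ y)) ~r
        (a, s) :: (x ++ [(b, s)] ++ (a, -s) :: (y ++ [(b, -s)])) := by
      simpa using List.isRotated_append (l := [(b, -s)])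
        (l' := (a, s) :: (x ++ (b, s) :: (a, -s) :: y))
    have k' : [(b, -s), (a, s)] ++ (x ++ ([(b, s), (a, -s)] ++ y)) ~r
        (b, -s) :: ((a, s) :: x ++ (b, s) :: ((a, -s) :: y)) := by simp [List.IsRotated.refl]
    refine .of_rotated hw k k' (by simp [add_comm]) ?_
    have f := isFlat_of_isRotated_cut hw k
    have f' := isFlat_of_isRotated_cut (s := -s) hw (by rw [neg_neg]; exact k')
    exact (flatJoin_concat_concat f).trans (flatJoin_cons_cons f').symm

/-! ### The crossings of a triangle -/

/-- The case in which the third strand separates the two paths on both sides of the move: before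
and after the move the smoothed words differ by exchanging the names of `b` and `c`. -/
lemma sameCrossing_corner_swap {a b c : ℕ} {u s ε : ℤˣ} {x y z : FlatWord}
    (hb : b ∉ flatCrossings (x ++ (y ++ z))) (hc : c ∉ flatCrossings (x ++ (y ++ z)))
    (hw : IsFlat ([(a, u), (b, s)] ++ (x ++ ([(c, -s), (a, -u)] ++
      (y ++ (flatOrd ε (b, -s) (c, s) ++ z))))))
    (hw' : IsFlat ([(b, s), (a, u)] ++ (x ++ ([(a, -u), (c, -s)] ++
      (y ++ (flatOrd (-ε) (b, -s) (c, s) ++ z)))))) :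
    SameCrossing ([(a, u), (b, s)] ++ (x ++ ([(c, -s), (a, -u)] ++
      (y ++ (flatOrd ε (b, -s) (c, s) ++ z))))) a
      ([(b, s), (a, u)] ++ (x ++ ([(a, -u), (c, -s)] ++
      (y ++ (flatOrd (-ε) (b, -s) (c, s) ++ z))))) a := by
  simp only [flatCrossings_append, Finset.mem_union, not_or] at hb hc
  have k : [(a, u), (b, s)] ++ (x ++ ([(c, -s), (a, -u)] ++
      (y ++ (flatOrd ε (b, -s) (c, s) ++ z)))) ~r
      (a, u) :: (((b, s) :: (x ++ [(c, -s)])) ++ (a, -u) ::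
        (y ++ (flatOrd ε (b, -s) (c, s) ++ z))) := by simp [List.IsRotated.refl]
  have k' : [(b, s), (a, u)] ++ (x ++ ([(a, -u), (c, -s)] ++
      (y ++ (flatOrd (-ε) (b, -s) (c, s) ++ z)))) ~r
      (a, u) :: (x ++ (a, -u) :: ((c, -s) ::
        (y ++ (flatOrd (-ε) (b, -s) (c, s) ++ (z ++ [(b, s)]))))) := by
    simpa using List.isRotated_append (l := [(b, s)]) (l' := (a, u) :: (x ++ (a, -u) :: (c, -s) ::
        (y ++ (flatOrd (-ε) (b, -s) (c, s) ++ z))))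
  refine .of_rotated hw hw' k k' (by simp) ?_
  refine .of_move_rotated (isFlat_flatJoin (isFlat_of_isRotated_cut hw k)) (.relabel
    (Equiv.swap b c) (Equiv.swap b c).injective _) (.refl _) ?_
  set S := shared ((b, s) :: (x ++ [(c, -s)])) (y ++ (flatOrd ε (b, -s) (c, s) ++ z)) with hS
  set S' := shared x ((c, -s) :: (y ++ (flatOrd (-ε) (b, -s) (c, s) ++ (z ++ [(b, s)])))) with hS'
  have hbS : b ∈ S := by simp [hS, shared, flatCrossings_flatOrd, -mem_flatCrossings]
  have hcS : c ∈ S := by simp [hS, shared, flatCrossings_flatOrd, -mem_flatCrossings]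
  have hbS' : b ∉ S' := fun h => hb.1 (Finset.mem_inter.1 h).1
  have hcS' : c ∉ S' := fun h => hc.1 (Finset.mem_inter.1 h).1
  have e : ∀ v, b ∉ flatCrossings v → c ∉ flatCrossings v →
      (v.map (twist S)).map (fun p => (Equiv.swap b c p.1, p.2)) = v.map (twist S') := by
    intro v hvb hvc
    rw [map_relabel_eq_self]
    · refine map_twist_congr fun d hd => ?_
      have h1 : d ≠ b := by rintro rfl; exact hvb hd
      have h2 : d ≠ c := by rintro rfl; exact hvc hd
      simp only [hS, hS', shared, flatCrossings_append, flatCrossings_cons, flatCrossings_flatOrd,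
        Finset.mem_inter, Finset.mem_union, Finset.mem_insert, Finset.mem_singleton,
        flatCrossings_nil, Finset.notMem_empty, h1, h2, or_false, false_or]
    · intro d hd
      rw [flatCrossings_map_twist] at hd
      refine Equiv.swap_apply_of_ne_of_ne ?_ ?_ <;> rintro rfl <;> contradiction
  rw [flatJoin, flatJoin, ← hS, ← hS']
  simp only [List.map_append, List.map_cons, List.cons_append, List.reverse_cons,
    List.reverse_append, List.map_nil, List.reverse_nil, List.nil_append, flatOrd_reverse,
    flatOrd_map, twist_mem hbS, twist_mem hcS, twist_notMem hbS', twist_notMem hcS',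
    Equiv.swap_apply_left, Equiv.swap_apply_right, neg_neg, List.append_assoc]
  rw [e x hb.1 hc.1, e y.reverse (by simpa only [flatCrossings_reverse] using hb.2.1)
    (by simpa only [flatCrossings_reverse] using hc.2.1),
    e z.reverse (by simpa only [flatCrossings_reverse] using hb.2.2)
    (by simpa only [flatCrossings_reverse] using hc.2.2), flatOrd_swap (-ε), neg_neg]
  simpa using List.isRotated_append (l := [(c, -s)]) (l' := x.map (twist S') ++ (b, s) ::
    (z.reverse.map (twist S') ++ (flatOrd ε (b, -s) (c, s) ++ y.reverse.map (twist S'))))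

lemma isBigon_flatOrd {b c : ℕ} {s ε : ℤˣ} :
    IsBigon c b [(c, s), (b, -s)] (flatOrd ε (b, s) (c, -s)) := by
  refine ⟨s, .inl rfl, ?_⟩
  unfold flatOrd; split_ifs
  · exact .inr rfl
  · exact .inl rfl

/-- The case in which the smoothing turns the third strand and one of the other two into a bigon
with corners `b` and `c`; removing it leaves the same word before and after the move. -/
lemma sameCrossing_corner_bigon {a b c : ℕ} {u s ε : ℤˣ} {x y z : FlatWord}
    (hbc : b ≠ c)
    (hb : b ∉ flatCrossings (x ++ (y ++ z))) (hc : c ∉ flatCrossings (x ++ (y ++ z)))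
    (hw : IsFlat ([(a, u), (b, s)] ++ (x ++ ([(a, -u), (c, s)] ++
      (y ++ (flatOrd ε (b, -s) (c, -s) ++ z))))))
    (hw' : IsFlat ([(b, s), (a, u)] ++ (x ++ ([(c, s), (a, -u)] ++
      (y ++ (flatOrd (-ε) (b, -s) (c, -s) ++ z)))))) :
    SameCrossing ([(a, u), (b, s)] ++ (x ++ ([(a, -u), (c, s)] ++
      (y ++ (flatOrd ε (b, -s) (c, -s) ++ z))))) a
      ([(b, s), (a, u)] ++ (x ++ ([(c, s), (a, -u)] ++
      (y ++ (flatOrd (-ε) (b, -s) (c, -s) ++ z))))) a := by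
  simp only [flatCrossings_append, Finset.mem_union, not_or] at hb hc
  have k : [(a, u), (b, s)] ++ (x ++ ([(a, -u), (c, s)] ++
      (y ++ (flatOrd ε (b, -s) (c, -s) ++ z)))) ~r
      (a, u) :: (((b, s) :: x) ++ (a, -u) :: ((c, s) ::
        (y ++ (flatOrd ε (b, -s) (c, -s) ++ z)))) := by simp [List.IsRotated.refl]
  have k' : [(b, s), (a, u)] ++ (x ++ ([(c, s), (a, -u)] ++
      (y ++ (flatOrd (-ε) (b, -s) (c, -s) ++ z)))) ~r
      (a, u) :: (x ++ [(c, s)] ++ (a, -u) ::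
        (y ++ (flatOrd (-ε) (b, -s) (c, -s) ++ (z ++ [(b, s)])))) := by
    simpa using List.isRotated_append (l := [(b, s)]) (l' := (a, u) :: (x ++ (c, s) :: (a, -u) ::
        (y ++ (flatOrd (-ε) (b, -s) (c, -s) ++ z))))
  refine .of_rotated hw hw' k k' (by simp [add_comm]) ?_
  set S := shared ((b, s) :: x) ((c, s) :: (y ++ (flatOrd ε (b, -s) (c, -s) ++ z))) with hS
  set S' := shared (x ++ [(c, s)])
    (y ++ (flatOrd (-ε) (b, -s) (c, -s) ++ (z ++ [(b, s)]))) with hS'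
  have hbS : b ∈ S := by simp [hS, shared, flatCrossings_flatOrd, -mem_flatCrossings]
  have hcS : c ∉ S := by
    simp [hS, shared, flatCrossings_flatOrd, -mem_flatCrossings, hc, hbc.symm]
  have hbS' : b ∉ S' := by
    simp [hS', shared, flatCrossings_flatOrd, -mem_flatCrossings, hb, hbc]
  have hcS' : c ∈ S' := by simp [hS', shared, flatCrossings_flatOrd, -mem_flatCrossings]
  have e : (x ++ (z.reverse ++ y.reverse)).map (twist S') =
      (x ++ (z.reverse ++ y.reverse)).map (twist S) := by
    refine map_twist_congr fun d hd => ?_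
    have h1 : d ≠ b := by
      rintro rfl; simp [hb, -mem_flatCrossings] at hd
    have h2 : d ≠ c := by
      rintro rfl; simp [hc, -mem_flatCrossings] at hd
    simp only [hS, hS', shared, flatCrossings_append, flatCrossings_cons, flatCrossings_flatOrd,
      Finset.mem_inter, Finset.mem_union, Finset.mem_insert, Finset.mem_singleton,
      flatCrossings_nil, Finset.notMem_empty, h1, h2, or_false, false_or]
  have m1 : FlatEq (flatJoin ((b, s) :: x) ((c, s) :: (y ++ (flatOrd ε (b, -s) (c, -s) ++ z))))
      ((x ++ (z.reverse ++ y.reverse)).map (twist S)) := by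
    refine .of_move_rotated (isFlat_flatJoin (isFlat_of_isRotated_cut hw k))
      (.r2 c b [(c, s), (b, -s)] (flatOrd (-ε) (b, s) (c, -s)) ((x ++ z.reverse).map (twist S))
        (y.reverse.map (twist S)) isBigon_flatOrd) ?_ ?_
    · rw [flatJoin, ← hS]
      simpa [flatOrd_reverse, flatOrd_map, twist_mem hbS, twist_notMem hcS] using
        List.isRotated_append (l := (b, -s) :: (x.map (twist S) ++ (z.reverse.map (twist S) ++
          (flatOrd (-ε) (b, s) (c, -s) ++ y.reverse.map (twist S))))) (l' := [(c, s)])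
    · simp [List.IsRotated.refl]
  have m2 : FlatEq (flatJoin (x ++ [(c, s)])
      (y ++ (flatOrd (-ε) (b, -s) (c, -s) ++ (z ++ [(b, s)]))))
      ((x ++ (z.reverse ++ y.reverse)).map (twist S')) := by
    refine .of_move_rotated (isFlat_flatJoin (isFlat_of_isRotated_cut hw' k'))
      (.r2 c b [(c, -s), (b, - -s)] (flatOrd ε (b, -s) (c, - -s)) (z.reverse.map (twist S'))
        ((y.reverse ++ x).map (twist S')) isBigon_flatOrd) ?_ ?_
    · rw [flatJoin, ← hS']
      simpa [flatOrd_reverse, flatOrd_map, twist_mem hcS', twist_notMem hbS'] using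
        List.isRotated_append (l := x.map (twist S')) (l' := (c, -s) :: (b, s) ::
          (z.reverse.map (twist S') ++ (flatOrd ε (b, -s) (c, s) ++ y.reverse.map (twist S'))))
    · rw [← List.map_append]
      refine List.IsRotated.map ?_ _
      simpa using List.isRotated_append (l := z.reverse ++ y.reverse) (l' := x)
  rw [e] at m2
  exact m1.trans m2.symm

lemma units_eq_of_mul_eq_one {s t : ℤˣ} (h : s * t = 1) : t = s := by
  rw [mul_eq_one_iff_inv_eq, Int.units_inv_eq_self] at h; exact h.symm

/-- The remaining crossings of the triangle follow by cyclic permutation of the strands. -/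
lemma sameCrossing_corner {a b c : ℕ} {P Q R x y z : FlatWord}
    (ht : IsTriangle a b c P Q R) (hw : IsFlat (P ++ (x ++ (Q ++ (y ++ (R ++ z)))))) :
    SameCrossing (P ++ (x ++ (Q ++ (y ++ (R ++ z))))) a
      (P.reverse ++ (x ++ (Q.reverse ++ (y ++ (R.reverse ++ z))))) a := by
  -- up to exchanging the two words, the passage of `a` comes first on the first strand
  have key : ∀ P Q R : FlatWord, ∀ ε u v t : ℤˣ, ε * u * v = 1 →
      P = flatOrd (ε * u * v) (a, u) (b, v) → Q = flatOrd (-(ε * u * t)) (c, t) (a, -u) →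
      R = flatOrd (ε * v * t) (b, -v) (c, -t) → IsFlat (P ++ (x ++ (Q ++ (y ++ (R ++ z))))) →
      SameCrossing (P ++ (x ++ (Q ++ (y ++ (R ++ z))))) a
        (P.reverse ++ (x ++ (Q.reverse ++ (y ++ (R.reverse ++ z))))) a := by
    intro P Q R ε u v t h1 hP hQ hR hw
    have ht : IsTriangle a b c P Q R := ⟨ε, u, v, t, hP, hQ, hR⟩
    have hw' := hw.of_move (.r3 a b c P Q R x y z ht)
    obtain ⟨-, hb, hc⟩ := ht.notMem hw (perm_triangle_front P Q R x y z)
    have hbc : b ≠ c := ht.rotate.rotate.ne (v := x ++ (y ++ z)) hw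
      ((perm_triangle_front P Q R x y z).trans (by
        rw [← Multiset.coe_eq_coe]; simp only [← Multiset.coe_add]; abel))
    have hv := units_eq_of_mul_eq_one h1
    rcases Int.units_eq_one_or (-(ε * u * t)) with h2 | h2
    · have h3 : t = -v := by
        rw [← neg_mul] at h2; rw [hv, units_eq_of_mul_eq_one h2]
      subst h3
      rw [h1] at hP
      rw [h2] at hQ
      rw [neg_neg] at hR
      have hP' : P = [(a, u), (b, v)] := by rw [hP]; simp [flatOrd]
      have hQ' : Q = [(c, -v), (a, -u)] := by rw [hQ]; simp [flatOrd]
      subst hP' hQ' hR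
      simp only [List.reverse_cons, List.reverse_nil, List.nil_append, List.cons_append,
        flatOrd_reverse] at hw'
      rw [flatOrd_reverse]
      exact sameCrossing_corner_swap hb hc hw hw'
    · have h3 : t = v := by
        rw [neg_inj] at h2; rw [hv, units_eq_of_mul_eq_one h2]
      subst h3
      rw [h1] at hP
      rw [h2] at hQ
      have hP' : P = [(a, u), (b, t)] := by rw [hP]; simp [flatOrd]
      have hQ' : Q = [(a, -u), (c, t)] := by rw [hQ]; simp [flatOrd]
      subst hP' hQ' hR
      simp only [List.reverse_cons, List.reverse_nil, List.nil_append, List.cons_append,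
        flatOrd_reverse] at hw'
      rw [flatOrd_reverse]
      exact sameCrossing_corner_bigon hbc hb hc hw hw'
  have hw' := hw.of_move (.r3 a b c P Q R x y z ht)
  obtain ⟨ε, u, v, t, hP, hQ, hR⟩ := ht
  rcases Int.units_eq_one_or (ε * u * v) with h | h
  · exact key P Q R ε u v t h hP hQ hR hw
  · have := key P.reverse Q.reverse R.reverse (-ε) u v t (by simp [h])
      (by rw [hP, flatOrd_reverse]; simp) (by rw [hQ, flatOrd_reverse]; simp)
      (by rw [hR, flatOrd_reverse]; simp) hw'
    simp only [List.reverse_reverse] at this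
    exact this.symm

/-! ### Flat writhes -/

/-- The odd function of `v` that is `1` at `n` and `-1` at `-n` (and zero everywhere if `n = 0`). -/
def oddDelta (n v : ℤ) : ℤ := (if v = n then 1 else 0) - if v = -n then 1 else 0

/-- The `n`-th difference writhe of a flat word: in `sgn c * oddDelta n (sgn c * i)` the signs
cancel, so it does not see the signs of the crossings. -/
noncomputable def flatWrithe (n : ℤ) (w : FlatWord) : ℤ :=
  ∑ c ∈ flatCrossings w, oddDelta n (flatIndex w c)

/-- The `(n, m)`-difference writhe of a flat word, for the convention of `flatSmooth`. -/
noncomputable def flatWrithe₂ (n m : ℤ) (w : FlatWord) : ℤ :=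
  ∑ c ∈ flatCrossings w,
    flatIndex w c * oddDelta m (flatIndex w c) * flatWrithe n (flatSmooth w c)

@[simp] lemma oddDelta_neg (n v : ℤ) : oddDelta n (-v) = -oddDelta n v := by
  have h1 : -v = n ↔ v = -n := by omega
  simp only [oddDelta, h1, neg_inj]; ring

@[simp] lemma oddDelta_zero (n : ℤ) : oddDelta n 0 = 0 := by
  have : (0 = n) ↔ (0 = -n) := by omega
  simp [oddDelta, this]

section Sums

variable {M : Type*} [AddCommGroup M] {val val' : ℕ → M}

lemma sum_kink {a : ℕ} {s : ℤˣ} {v : FlatWord} (hw : IsFlat ((a, s) :: (a, -s) :: v))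
    (h0 : val a = 0) (h : ∀ c ∈ flatCrossings v, val c = val' c) :
    ∑ c ∈ flatCrossings ((a, s) :: (a, -s) :: v), val c = ∑ c ∈ flatCrossings v, val' c := by
  have ha : a ∉ flatCrossings v := notMem_kink hw (.refl _)
  rw [flatCrossings_cons, flatCrossings_cons, Finset.insert_idem, Finset.sum_insert ha, h0,
    zero_add]
  exact Finset.sum_congr rfl h

lemma sum_bigon {a b : ℕ} {P Q x y : FlatWord} (hb : IsBigon a b P Q)
    (hw : IsFlat (P ++ (x ++ (Q ++ y)))) (h0 : val a + val b = 0)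
    (h : ∀ c ∈ flatCrossings (x ++ y), val c = val' c) :
    ∑ c ∈ flatCrossings (P ++ (x ++ (Q ++ y))), val c =
      ∑ c ∈ flatCrossings (x ++ y), val' c := by
  obtain ⟨ha, hb'⟩ := hb.notMem hw (perm_bigon P Q x y)
  have hab : a ≠ b := (hb.isFlat (hw.perm (perm_bigon P Q x y))).2
  have e : flatCrossings (P ++ (x ++ (Q ++ y))) = insert a (insert b (flatCrossings (x ++ y))) := by
    rw [flatCrossings_perm (perm_bigon P Q x y), flatCrossings_append, flatCrossings_append,
      hb.flatCrossings_left, hb.flatCrossings_right]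
    ext c; simp [-mem_flatCrossings]
  rw [e, Finset.sum_insert (by rw [Finset.mem_insert, not_or]; exact ⟨hab, ha⟩), Finset.sum_insert hb',
    ← add_assoc, h0, zero_add]
  exact Finset.sum_congr rfl h

end Sums

lemma flatCrossings_triangle (P Q R x y z : FlatWord) :
    flatCrossings (P.reverse ++ (x ++ (Q.reverse ++ (y ++ (R.reverse ++ z))))) =
      flatCrossings (P ++ (x ++ (Q ++ (y ++ (R ++ z))))) :=
  (flatCrossings_perm (perm_triangle P Q R x y z)).symm

/-- A third Reidemeister move changes neither the index of a crossing nor, up to equivalence,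
the result of smoothing it. -/
lemma sameCrossing_of_triangle {a b c d : ℕ} {P Q R x y z : FlatWord}
    (ht : IsTriangle a b c P Q R) (hw : IsFlat (P ++ (x ++ (Q ++ (y ++ (R ++ z))))))
    (hd : d ∈ flatCrossings (P ++ (x ++ (Q ++ (y ++ (R ++ z)))))) :
    SameCrossing (P ++ (x ++ (Q ++ (y ++ (R ++ z))))) d
      (P.reverse ++ (x ++ (Q.reverse ++ (y ++ (R.reverse ++ z))))) d := by
  have hw' := hw.of_move (.r3 a b c P Q R x y z ht)
  have hd' := hd
  rw [flatCrossings_perm (perm_triangle_front P Q R x y z), flatCrossings_append, flatCrossings_append,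
    flatCrossings_append, ht.flatCrossings_left, ht.flatCrossings_middle, ht.flatCrossings_right,
    Finset.mem_union] at hd'
  -- a rotation of the word puts any of the three strands in front
  have rot : ∀ {P Q R x y z : FlatWord} {a b c : ℕ}, IsTriangle a b c P Q R →
      P ++ (x ++ (Q ++ (y ++ (R ++ z)))) ~r Q ++ (y ++ (R ++ (z ++ (P ++ x)))) := by
    intro P Q R x y z _ _ _ _
    simpa using List.isRotated_append (l := P ++ x) (l' := Q ++ (y ++ (R ++ z)))
  have step : ∀ {P Q R x y z : FlatWord} {a b c : ℕ}, IsTriangle a b c P Q R →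
      IsFlat (P ++ (x ++ (Q ++ (y ++ (R ++ z))))) →
      d ∈ flatCrossings (P ++ (x ++ (Q ++ (y ++ (R ++ z))))) →
      SameCrossing (Q ++ (y ++ (R ++ (z ++ (P ++ x))))) d
        (Q.reverse ++ (y ++ (R.reverse ++ (z ++ (P.reverse ++ x))))) d →
      SameCrossing (P ++ (x ++ (Q ++ (y ++ (R ++ z))))) d
        (P.reverse ++ (x ++ (Q.reverse ++ (y ++ (R.reverse ++ z))))) d := by
    intro P Q R x y z a b c ht hw hd h
    have hw' := hw.of_move (.r3 a b c P Q R x y z ht)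
    have h1 := SameCrossing.rotate hw (rot ht) hd
    have h2 := SameCrossing.rotate hw' (rot ht.reverse)
      (by rw [flatCrossings_triangle]; exact hd)
    exact ⟨h1.1.trans (h.1.trans h2.1.symm), h1.2.trans (h.2.trans h2.2.symm)⟩
  rcases hd' with hd' | hd'
  · have : d = a ∨ d = c ∨ d = b := by
      simp only [Finset.mem_union, Finset.mem_insert, Finset.mem_singleton] at hd'; tauto
    rcases this with rfl | rfl | rfl
    · exact sameCrossing_corner ht hw
    · exact step ht hw hd (sameCrossing_corner ht.rotate (hw.perm (rot ht).perm))
    · have k := (rot ht (x := x) (y := y) (z := z)).perm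
      have k' := (rot ht.rotate (x := y) (y := z) (z := x)).perm
      exact step ht hw hd (step ht.rotate (hw.perm k)
        (by rw [← flatCrossings_perm k]; exact hd)
        (sameCrossing_corner ht.rotate.rotate ((hw.perm k).perm k')))
  · exact sameCrossing_triangle ht hw hd'

/-- A sum over crossings is invariant under flat moves if the summand at a crossing depends only on
its index and its smoothing up to equivalence, cancels for opposite crossings, and vanishes at
index zero. -/
lemma FlatMove.sum_eq {w w' : FlatWord} (m : FlatMove w w') (hw : IsFlat w)
    (val : FlatWord → ℕ → ℤ)
    (hs : ∀ w w' c c', SameCrossing w c w' c' → val w c = val w' c')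
    (ho : ∀ w a b, IsFlat w → b ∈ flatCrossings w → OppositeCrossings w a b →
      val w a + val w b = 0)
    (hz : ∀ w c, flatIndex w c = 0 → val w c = 0) :
    ∑ c ∈ flatCrossings w, val w c = ∑ c ∈ flatCrossings w', val w' c := by
  cases m with
  | rotate _ _ h =>
    rw [← flatCrossings_perm h.perm]
    exact Finset.sum_congr rfl fun c hc => hs _ _ _ _ (.rotate hw h hc)
  | relabel f hf =>
    have e : flatCrossings (w.map fun p => (f p.1, p.2)) = (flatCrossings w).image f := by
      ext c; simp [flatCrossings]
    rw [e, Finset.sum_image hf.injOn]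
    exact Finset.sum_congr rfl fun c hc => hs _ _ _ _ (.relabel hw hf hc)
  | r1 a s v =>
    exact sum_kink hw (hz _ _ (flatIndex_kink hw)) fun c hc => hs _ _ _ _ (sameCrossing_kink hw hc)
  | r2 a b P Q x y h =>
    exact sum_bigon h hw (ho _ _ _ hw (by
        rw [flatCrossings_append, h.flatCrossings_left]; simp [-mem_flatCrossings])
      (bigon_crossings h hw))
      fun c hc => hs _ _ _ _ (sameCrossing_bigon h hw hc)
  | r3 a b c P Q R x y z h =>
    rw [flatCrossings_triangle]
    exact Finset.sum_congr rfl fun d hd => hs _ _ _ _ (sameCrossing_of_triangle h hw hd)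

lemma flatWrithe_eq (n : ℤ) {v w : FlatWord} (h : FlatEq v w) : flatWrithe n v = flatWrithe n w := by
  induction h with
  | rel v w h =>
    refine h.2.sum_eq h.1 (fun w c => oddDelta n (flatIndex w c)) ?_ ?_ ?_
    · intro w w' c c' h; rw [h.1]
    · intro w a b _ _ h; rw [h.1]; simp
    · intro w c h; simp [h]
  | refl => rfl
  | symm _ _ _ ih => exact ih.symm
  | trans _ _ _ _ _ ih ih' => exact ih.trans ih'

lemma flatWrithe_reverse (n : ℤ) {w : FlatWord} (hw : IsFlat w) :
    flatWrithe n w.reverse = -flatWrithe n w := by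
  rw [flatWrithe, flatWrithe, flatCrossings_reverse, ← Finset.sum_neg_distrib]
  exact Finset.sum_congr rfl fun c hc => by rw [flatIndex_reverse hw hc, oddDelta_neg]

lemma flatWrithe₂_eq (n m : ℤ) {v w : FlatWord} (h : FlatEq v w) :
    flatWrithe₂ n m v = flatWrithe₂ n m w := by
  induction h with
  | rel v w h =>
    refine h.2.sum_eq h.1 (fun w c => flatIndex w c * oddDelta m (flatIndex w c) *
      flatWrithe n (flatSmooth w c)) ?_ ?_ ?_
    · intro w w' c c' h; simp only [h.1, flatWrithe_eq n h.2]
    · intro w a b hw hb h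
      simp only [h.1, flatWrithe_eq n h.2, flatWrithe_reverse n (isFlat_flatSmooth hw hb),
        oddDelta_neg]
      ring
    · intro w c h; simp [h]
  | refl => rfl
  | symm _ _ _ ih => exact ih.symm
  | trans _ _ _ _ _ ih ih' => exact ih.trans ih'

/-- The reversal negates the index as well as `oddDelta` and does not change the smoothings. -/
lemma flatWrithe₂_reverse (n m : ℤ) {w : FlatWord} (hw : IsFlat w) :
    flatWrithe₂ n m w.reverse = flatWrithe₂ n m w := by
  rw [flatWrithe₂, flatWrithe₂, flatCrossings_reverse]
  refine Finset.sum_congr rfl fun c hc => ?_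
  rw [flatIndex_reverse hw hc, oddDelta_neg, flatWrithe_eq n (flatSmooth_reverse hw hc)]
  ring

/-! ### The flat word of a Gauss word -/

/-- The passage without over/under information; the step is that of `Passage.labelStep`. -/
def Passage.flat (p : Passage) : ℕ × ℤˣ := (p.crossing, if p.isOver then -p.sign else p.sign)

/-- The flat word of a Gauss word. -/
def flatten (w : List Passage) : FlatWord := w.map Passage.flat

/-- The conditions on the word of a `Diagram`. They are needed for the words of smoothed diagrams,
which are not bundled. -/
def IsGauss (w : List Passage) : Prop :=
  (w.map fun p => (p.crossing, p.isOver)).Nodup ∧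
    ∀ p ∈ w, (⟨p.crossing, !p.isOver, p.sign⟩ : Passage) ∈ w

lemma Diagram.isGauss (D : Diagram) : IsGauss D.word := ⟨D.nodup, D.paired⟩

@[simp] lemma flatten_nil : flatten [] = [] := rfl

@[simp] lemma flatten_cons (p : Passage) (w : List Passage) :
    flatten (p :: w) = p.flat :: flatten w := rfl

@[simp] lemma flatten_append (v w : List Passage) :
    flatten (v ++ w) = flatten v ++ flatten w := List.map_append

@[simp] lemma flatten_reverse (w : List Passage) : flatten w.reverse = (flatten w).reverse :=
  List.map_reverse

@[simp] lemma flat_fst (p : Passage) : p.flat.1 = p.crossing := rfl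

lemma flatCrossings_flatten (w : List Passage) : flatCrossings (flatten w) = crossings w := by
  rw [flatCrossings, crossings, flatten, List.map_map]; rfl

lemma mem_crossings {w : List Passage} {c : ℕ} : c ∈ crossings w ↔ ∃ p ∈ w, p.crossing = c := by
  simp [crossings]

lemma IsGauss.eq_of_key {w : List Passage} (hw : IsGauss w) {p q : Passage} (hp : p ∈ w)
    (hq : q ∈ w) (hc : p.crossing = q.crossing) (ho : p.isOver = q.isOver) : p = q :=
  List.inj_on_of_nodup_map hw.1 hp hq (by simp [hc, ho])

lemma IsGauss.sign_eq {w : List Passage} (hw : IsGauss w) {p q : Passage} (hp : p ∈ w)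
    (hq : q ∈ w) (hc : p.crossing = q.crossing) : p.sign = q.sign := by
  by_cases ho : p.isOver = q.isOver
  · rw [hw.eq_of_key hp hq hc ho]
  · have := hw.eq_of_key (hw.2 p hp) hq hc (by cases h : p.isOver <;> simp_all)
    rw [← this]

lemma IsGauss.nodup {w : List Passage} (hw : IsGauss w) : w.Nodup := List.Nodup.of_map _ hw.1

lemma units_ne_neg (s : ℤˣ) : s ≠ -s := by
  rcases Int.units_eq_one_or s with rfl | rfl <;> decide

lemma IsGauss.isFlat {w : List Passage} (hw : IsGauss w) : IsFlat (flatten w) := by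
  refine ⟨List.Nodup.map_on ?_ hw.nodup, fun p hp => ?_⟩
  · intro p hp q hq h
    have hc : p.crossing = q.crossing := congrArg Prod.fst h
    have h2 : (if p.isOver then -p.sign else p.sign) = if q.isOver then -q.sign else q.sign :=
      congrArg Prod.snd h
    refine hw.eq_of_key hp hq hc ?_
    rw [hw.sign_eq hp hq hc] at h2
    have := units_ne_neg q.sign
    cases h3 : p.isOver <;> cases h4 : q.isOver <;> simp [h3, h4] at h2 ⊢
  · obtain ⟨q, hq, rfl⟩ := List.mem_map.1 hp
    refine List.mem_map.2 ⟨_, hw.2 q hq, ?_⟩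
    cases h : q.isOver <;> simp [Passage.flat, h]

lemma IsGauss.sgn_eq {w : List Passage} (hw : IsGauss w) {p : Passage} (hp : p ∈ w) :
    sgn w p.crossing = p.sign := by
  rw [sgn]
  cases h : w.find? fun q => q.crossing = p.crossing with
  | none =>
    rw [List.find?_eq_none] at h
    exact absurd (decide_eq_true rfl) (h p hp)
  | some q =>
    have h1 := List.mem_of_find?_eq_some h
    have h2 := List.find?_some h
    simp only [decide_eq_true_eq] at h2
    simp [hw.sign_eq h1 hp h2]

lemma labelStep_eq (p : Passage) : p.labelStep = (p.flat.2 : ℤ) := by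
  unfold Passage.labelStep Passage.flat; split_ifs <;> simp

lemma sum_labelStep (w : List Passage) : (w.map Passage.labelStep).sum = steps (flatten w) := by
  rw [steps, flatten, List.map_map]; exact congrArg _ (List.map_congr_left fun p _ => labelStep_eq p)

lemma takeWhile_append_cons {α : Type*} {q : α → Bool} {A R : List α} {p : α}
    (hA : ∀ x ∈ A, q x = true) (hp : q p = false) : (A ++ p :: R).takeWhile q = A := by
  rw [List.takeWhile_append_of_pos hA, List.takeWhile_cons]
  simp [hp]

lemma dropWhile_append_cons {α : Type*} {q : α → Bool} {A R : List α} {p : α}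
    (hA : ∀ x ∈ A, q x = true) (hp : q p = false) : (A ++ p :: R).dropWhile q = p :: R := by
  rw [List.dropWhile_append_of_pos hA, List.dropWhile_cons]
  simp [hp]

lemma labelIn_eq {w A R : List Passage} {p : Passage} (hw : IsGauss w) (h : w = A ++ p :: R) :
    labelIn w p.crossing p.isOver = steps (flatten A) := by
  have hn := hw.nodup
  rw [labelIn, ← sum_labelStep]
  rw [h] at hn
  congr 2
  conv_lhs => rw [h]
  refine takeWhile_append_cons (fun x hx => ?_) (by simp)
  by_contra hc
  have hx' : x.crossing = p.crossing ∧ x.isOver = p.isOver := by simpa using hc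
  have := hw.eq_of_key (p := x) (q := p) (by simp [h, hx]) (by simp [h]) hx'.1 hx'.2
  exact (List.nodup_append'.1 hn).2.2 hx (by simp [this])

lemma fromOverpass_eq {w A R : List Passage} {p : Passage} (hw : IsGauss w)
    (h : w = A ++ p :: R) (hp : p.isOver = true) : fromOverpass w p.crossing = R ++ A := by
  have hn := hw.nodup
  have hi : (w.findIdx fun q => q.crossing = p.crossing ∧ q.isOver = true) = A.length := by
    rw [h] at hn
    conv_lhs => rw [h]
    rw [List.findIdx_append, if_neg]
    · simp [hp, List.findIdx_cons]
    · rw [List.findIdx_lt_length]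
      rintro ⟨x, hx, hc⟩
      have hx' : x.crossing = p.crossing ∧ x.isOver = p.isOver := by simpa [hp] using hc
      have := hw.eq_of_key (p := x) (q := p) (by simp [h, hx]) (by simp [h]) hx'.1 hx'.2
      exact (List.nodup_append'.1 hn).2.2 hx (by simp [this])
  rw [fromOverpass, hi, h, List.rotate_append_length_eq]
  rfl

/-- The index and the two paths of a smoothing, read off from a rotation of the word that starts at
the overpass. In contrast to `flatIndex`, the formula for `ind` involves the path from the overpass,
and no sign. -/
lemma exists_overUnder {w : List Passage} (hw : IsGauss w) {c : ℕ} (hc : c ∈ crossings w) :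
    ∃ s : ℤˣ, sgn w c = s ∧
      w ~r ⟨c, true, s⟩ :: (overToUnder w c ++ ⟨c, false, s⟩ :: underToOver w c) ∧
      ind w c = -steps (flatten (overToUnder w c)) := by
  have ⟨s, ho, hu⟩ : ∃ s, (⟨c, true, s⟩ : Passage) ∈ w ∧ (⟨c, false, s⟩ : Passage) ∈ w := by
    obtain ⟨⟨c, o, s⟩, hp, rfl⟩ := mem_crossings.1 hc
    have := hw.2 _ hp
    cases o
    · exact ⟨s, this, hp⟩
    · exact ⟨s, hp, this⟩
  have hs : sgn w c = s := hw.sgn_eq ho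
  have hz := hw.isFlat.steps_eq_zero
  obtain ⟨A, R, h⟩ := List.append_of_mem ho
  have hf : fromOverpass w c = R ++ A := fromOverpass_eq hw h rfl
  have hr : w ~r ⟨c, true, s⟩ :: (R ++ A) := by
    rw [h]; simpa using List.isRotated_append (l := A) (l' := ⟨c, true, s⟩ :: R)
  have hl := labelIn_eq hw h
  dsimp only at hl
  -- no passage of `c` other than the underpass occurs behind the overpass
  have hsplit : ∀ x y, R ++ A = x ++ ⟨c, false, s⟩ :: y →
      overToUnder w c = x ∧ underToOver w c = y := by
    intro x y e
    rw [e] at hr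
    have hn : ((⟨c, true, s⟩ : Passage) :: (x ++ ⟨c, false, s⟩ :: y)).Nodup :=
      hr.nodup_iff.1 hw.nodup
    rw [List.nodup_cons, List.nodup_append'] at hn
    have hx : ∀ p ∈ x, (!(decide (p.crossing = c))) = true := by
      intro p hp
      by_contra hpc
      have hpc : p.crossing = c := by simpa using hpc
      have hpw : p ∈ w := hr.mem_iff.2 (by simp [hp])
      cases hpo : p.isOver
      · have := hw.eq_of_key hpw hu hpc hpo
        exact hn.2.2.2 hp (by simp [this])
      · have := hw.eq_of_key hpw ho hpc hpo
        exact hn.1 (by simp [← this, hp])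
    rw [overToUnder, underToOver, hf, e]
    exact ⟨takeWhile_append_cons hx (by simp), by rw [dropWhile_append_cons hx (by simp)]; rfl⟩
  have hu' : (⟨c, false, s⟩ : Passage) ∈ R ∨ (⟨c, false, s⟩ : Passage) ∈ A := by
    rw [h] at hu; simpa [or_comm] using hu
  have hind : labelIn w c false - labelIn w c true = -s + steps (flatten (overToUnder w c)) →
      ind w c = -steps (flatten (overToUnder w c)) := by
    intro hd
    rw [ind, hs]
    rcases Int.units_eq_one_or s with rfl | rfl
    · simp at hd ⊢; linarith
    · simp at hd ⊢; linarith
  refine ⟨s, hs, ?_⟩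
  rcases hu' with hm | hm
  · obtain ⟨x, y, rfl⟩ := List.append_of_mem hm
    obtain ⟨h1, h2⟩ := hsplit x (y ++ A) (by simp)
    have hl' := labelIn_eq (A := A ++ ⟨c, true, s⟩ :: x) (p := ⟨c, false, s⟩) (R := y) hw
      (by simp [h])
    dsimp only at hl'
    refine ⟨by rw [h1, h2]; simpa using hr, hind ?_⟩
    rw [hl, hl', h1]
    simp [Passage.flat]
  · obtain ⟨x, y, rfl⟩ := List.append_of_mem hm
    obtain ⟨h1, h2⟩ := hsplit (R ++ x) y (by simp)
    have hl' := labelIn_eq (A := x) (p := ⟨c, false, s⟩) (R := y ++ ⟨c, true, s⟩ :: R) hw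
      (by simp [h])
    dsimp only at hl'
    refine ⟨by rw [h1, h2]; simpa using hr, hind ?_⟩
    rw [hl, hl', h1]
    rw [h] at hz
    simp [Passage.flat] at hz ⊢
    linarith

/-! ### Smoothing -/

lemma any_crossing {x : List Passage} {c : ℕ} :
    (x.any fun q => q.crossing = c) = true ↔ c ∈ flatCrossings (flatten x) := by
  simp [flatCrossings_flatten, mem_crossings]

lemma flatten_joinReversed (x y : List Passage) :
    flatten (joinReversed x y) = flatJoin (flatten x) (flatten y) := by
  rw [flatJoin, ← flatten_reverse, ← flatten_append, joinReversed]
  unfold flatten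
  rw [List.map_map, List.map_map]
  change _ = List.map (twist (shared (flatten x) (flatten y)) ∘ Passage.flat) _
  refine List.map_congr_left fun p _ => ?_
  simp only [Function.comp_apply, Bool.and_eq_true, any_crossing]
  by_cases h : p.crossing ∈ shared (flatten x) (flatten y)
  · rw [if_pos (Finset.mem_inter.1 h)]
    cases ho : p.isOver <;> simp [twist, h, Passage.flat, ho]
  · rw [if_neg (fun h' => h (Finset.mem_inter.2 h'))]
    simp [twist, h]

lemma isGauss_joinReversed {w x y : List Passage} {c : ℕ} {s : ℤˣ} (hw : IsGauss w)
    (h : w.Perm (⟨c, true, s⟩ :: ⟨c, false, s⟩ :: (x ++ y))) : IsGauss (joinReversed x y) := by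
  have hn : ((x ++ y).map fun p => (p.crossing, p.isOver)).Nodup ∧
      ∀ p ∈ x ++ y, p.crossing ≠ c := by
    have := (h.map fun p => (p.crossing, p.isOver)).nodup_iff.1 hw.1
    rw [List.map_cons, List.map_cons, List.nodup_cons, List.nodup_cons] at this
    refine ⟨this.2.2, fun p hp hpc => ?_⟩
    have hm := List.mem_map_of_mem (f := fun p : Passage => (p.crossing, p.isOver)) hp
    cases ho : p.isOver
    · simp only [hpc, ho] at hm; exact this.2.1 hm
    · simp only [hpc, ho] at hm; exact this.1 (List.mem_cons_of_mem _ hm)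
  have hp' : (x ++ y.reverse).Perm (x ++ y) := (List.Perm.refl x).append y.reverse_perm
  constructor
  · have : ((joinReversed x y).map fun p => (p.crossing, p.isOver)) =
        (x ++ y.reverse).map fun p => (p.crossing, p.isOver) := by
      rw [joinReversed, List.map_map]
      refine List.map_congr_left fun p _ => ?_
      simp only [Function.comp_apply]; split_ifs <;> rfl
    rw [this]
    exact (hp'.map _).nodup_iff.2 hn.1
  · intro p hp
    obtain ⟨q, hq, rfl⟩ := List.mem_map.1 hp
    have hq' := hp'.mem_iff.1 hq
    have h1 := h.mem_iff.1 (hw.2 q (h.mem_iff.2 (by simp only [List.mem_cons]; tauto)))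
    have h2 : (⟨q.crossing, !q.isOver, q.sign⟩ : Passage) ∈ x ++ y.reverse := by
      refine hp'.mem_iff.2 ?_
      have hc := hn.2 q hq'
      simp only [List.mem_cons, Passage.mk.injEq, hc, false_and, false_or] at h1
      exact h1
    refine List.mem_map.2 ⟨_, h2, ?_⟩
    dsimp only
    split_ifs <;> rfl

lemma isGauss_smooth (κ : Bool) {w : List Passage} (hw : IsGauss w) {c : ℕ}
    (hc : c ∈ crossings w) : IsGauss (smooth κ w c) := by
  obtain ⟨s, -, h, -⟩ := exists_overUnder hw hc
  have h1 : w.Perm (⟨c, true, s⟩ :: ⟨c, false, s⟩ :: (overToUnder w c ++ underToOver w c)) :=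
    h.perm.trans (.cons _ List.perm_middle)
  cases κ
  · exact isGauss_joinReversed hw (h1.trans (.cons _ (.cons _ List.perm_append_comm)))
  · exact isGauss_joinReversed hw h1

/-- The sign by which the convention `κ` for smoothings enters the difference writhes. -/
def conventionSign (κ : Bool) : ℤ := if κ then -1 else 1

/-- Indices and smoothings of a diagram agree with the flat ones up to sign and up to reversal. -/
lemma ind_and_smooth (κ : Bool) {w : List Passage} (hw : IsGauss w) {c : ℕ}
    (hc : c ∈ crossings w) :
    ind w c = sgn w c * flatIndex (flatten w) c ∧ (sgn w c = 1 ∨ sgn w c = -1) ∧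
      flatten (smooth κ w c) = if conventionSign κ * sgn w c = 1
        then flatSmooth (flatten w) c else (flatSmooth (flatten w) c).reverse := by
  obtain ⟨s, hs, h, hi⟩ := exists_overUnder hw hc
  set x := overToUnder w c with hx
  set y := underToOver w c with hy
  have hf := hw.isFlat
  have hr : flatten w ~r (c, -s) :: (flatten x ++ (c, s) :: flatten y) := by
    simpa [flatten, Passage.flat] using List.IsRotated.map h Passage.flat
  have hsm : ∀ κ, smooth κ w c = if κ then joinReversed x y else joinReversed y x :=
    fun κ => rfl
  rw [hs, hsm, hi]
  rcases Int.units_eq_one_or s with rfl | rfl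
  · have k := isCut_neg hr
    have := k.steps_add hf
    refine ⟨by rw [k.flatIndex_eq hf]; simp; linarith, by simp, ?_⟩
    rw [k.flatSmooth_eq hf]
    cases κ <;> simp [conventionSign, flatten_joinReversed, flatJoin_reverse]
  · rw [neg_neg] at hr
    refine ⟨by rw [IsCut.flatIndex_eq hf hr]; simp, by simp, ?_⟩
    rw [IsCut.flatSmooth_eq hf hr]
    cases κ <;> simp [conventionSign, flatten_joinReversed, flatJoin_reverse]

/-! ### The writhes in terms of flat words -/

lemma sgn_mul_oddDelta {s : ℤ} (hs : s = 1 ∨ s = -1) (n v : ℤ) :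
    s * oddDelta n (s * v) = oddDelta n v := by
  rcases hs with rfl | rfl <;> simp

lemma sum_filter_sub (S : Finset ℕ) (f g : ℕ → ℤ) (n : ℤ) :
    (∑ c ∈ S with g c = n, f c) - (∑ c ∈ S with g c = -n, f c) =
      ∑ c ∈ S, f c * oddDelta n (g c) := by
  rw [Finset.sum_filter, Finset.sum_filter, ← Finset.sum_sub_distrib]
  refine Finset.sum_congr rfl fun c _ => ?_
  rw [oddDelta]; split_ifs <;> simp

lemma dwrithe_eq (n : ℤ) {w : List Passage} (hw : IsGauss w) :
    dwrithe n w = flatWrithe n (flatten w) := by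
  rw [dwrithe, writhe, writhe, sum_filter_sub, flatWrithe, flatCrossings_flatten]
  refine Finset.sum_congr rfl fun c hc => ?_
  obtain ⟨h1, h2, -⟩ := ind_and_smooth true hw hc
  rw [h1, sgn_mul_oddDelta h2]

lemma dwrithe_smooth (κ : Bool) (n : ℤ) {w : List Passage} (hw : IsGauss w) {c : ℕ}
    (hc : c ∈ crossings w) : dwrithe n (smooth κ w c) =
      conventionSign κ * sgn w c * flatWrithe n (flatSmooth (flatten w) c) := by
  obtain ⟨-, h2, h3⟩ := ind_and_smooth κ hw hc
  have hf := isFlat_flatSmooth hw.isFlat (by rwa [flatCrossings_flatten])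
  rw [dwrithe_eq n (isGauss_smooth κ hw hc), h3]
  rcases h2 with h | h <;> cases κ <;> simp [h, conventionSign, flatWrithe_reverse n hf]

lemma dwrithe₂_eq (κ : Bool) (n m : ℤ) {w : List Passage} (hw : IsGauss w) :
    dwrithe₂ κ n m w = conventionSign κ * flatWrithe₂ n m (flatten w) := by
  rw [dwrithe₂, sum_filter_sub, flatWrithe₂, flatCrossings_flatten, Finset.mul_sum]
  refine Finset.sum_congr rfl fun c hc => ?_
  obtain ⟨h1, h2, -⟩ := ind_and_smooth κ hw hc
  rw [h1, dwrithe_smooth κ n hw hc]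
  rcases h2 with h | h <;> rw [h] <;> simp <;> ring

lemma dwrithe₂_smooth (κ : Bool) (n m : ℤ) {w : List Passage} (hw : IsGauss w) {c : ℕ}
    (hc : c ∈ crossings w) : dwrithe₂ κ n m (smooth κ w c) =
      conventionSign κ * flatWrithe₂ n m (flatSmooth (flatten w) c) := by
  obtain ⟨-, -, h3⟩ := ind_and_smooth κ hw hc
  have hf := isFlat_flatSmooth hw.isFlat (by rwa [flatCrossings_flatten])
  rw [dwrithe₂_eq κ n m (isGauss_smooth κ hw hc), h3]
  split_ifs
  · rfl
  · rw [flatWrithe₂_reverse n m hf]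

/-! ### Moves of Gauss words -/

lemma flatten_inOrder (ε : ℤˣ) (p q : Passage) :
    flatten (inOrder ε p q) = flatOrd ε p.flat q.flat := by
  unfold inOrder flatOrd; split_ifs <;> rfl

lemma isTriangle_flatten (a b c : ℕ) (sa sb sc ε : ℤˣ) :
    IsTriangle a b c (flatten (inOrder (ε * sa * sb) ⟨a, true, sa⟩ ⟨b, true, sb⟩))
      (flatten (inOrder (ε * sa * sc) ⟨a, false, sa⟩ ⟨c, true, sc⟩))
      (flatten (inOrder (ε * sb * sc) ⟨b, false, sb⟩ ⟨c, false, sc⟩)) := by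
  refine ⟨ε, -sa, -sb, -sc, ?_, ?_, ?_⟩ <;> rw [flatten_inOrder]
  · simp [Passage.flat]
  · rw [flatOrd_swap]; simp [Passage.flat]
  · simp [Passage.flat]

lemma flatten_inOrder_neg (ε s t : ℤˣ) (p q : Passage) :
    flatten (inOrder (-ε * s * t) p q) = (flatten (inOrder (ε * s * t) p q)).reverse := by
  rw [flatten_inOrder, flatten_inOrder, flatOrd_reverse, neg_mul, neg_mul]

lemma Move.flat {w w' : List Passage} (m : Move w w') : FlatMove (flatten w) (flatten w') := by
  cases m with
  | rotate _ _ h => exact .rotate _ _ (h.map _)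
  | relabel f hf w =>
    have : flatten (w.map fun p => ⟨f p.crossing, p.isOver, p.sign⟩) =
        (flatten w).map fun p => (f p.1, p.2) := by
      simp [flatten, Function.comp_def, Passage.flat]
    rw [this]; exact .relabel f hf _
  | reidemeister1 a o s w =>
    have : flatten (⟨a, o, s⟩ :: ⟨a, !o, s⟩ :: w') = (a, if o then -s else s) ::
        (a, -(if o then -s else s)) :: flatten w' := by
      cases o <;> simp [Passage.flat]
    rw [this]; exact .r1 _ _ _
  | reidemeister2_direct a b s x y =>
    have := FlatMove.r2 a b [(a, -s), (b, - -s)] [(a, - -s), (b, -s)] (flatten x) (flatten y)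
      ⟨-s, by simp, by simp⟩
    simpa [Passage.flat] using this
  | reidemeister2_reverse a b s x y =>
    have := FlatMove.r2 a b [(a, -s), (b, - -s)] [(b, -s), (a, - -s)] (flatten x) (flatten y)
      ⟨-s, by simp, by simp⟩
    simpa [Passage.flat] using this
  | reidemeister3_tmb a b c sa sb sc ε x y z =>
    simpa only [flatten_append, flatten_inOrder_neg, List.append_assoc] using
      FlatMove.r3 a b c _ _ _ (flatten x) (flatten y) (flatten z)
        (isTriangle_flatten a b c sa sb sc ε)
  | reidemeister3_tbm a b c sa sb sc ε x y z =>
    simpa only [flatten_append, flatten_inOrder_neg, List.append_assoc] using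
      FlatMove.r3 b a c _ _ _ (flatten x) (flatten y) (flatten z)
        (isTriangle_flatten a b c sa sb sc ε).swap

lemma Equivalent.flatEq {D D' : Diagram} (h : Equivalent D D') :
    FlatEq (flatten D.word) (flatten D'.word) := by
  induction h with
  | rel D D' h => exact .of_move D.isGauss.isFlat h.flat
  | refl => exact .refl _
  | symm _ _ _ ih => exact ih.symm
  | trans _ _ _ _ _ ih ih' => exact ih.trans ih'

/-! ### The values at reducible crossings -/

lemma flatten_kink (a : ℕ) (o : Bool) (s : ℤˣ) (v : List Passage) :
    flatten (⟨a, o, s⟩ :: ⟨a, !o, s⟩ :: v) = (a, if o then -s else s) ::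
        (a, -(if o then -s else s)) :: flatten v := by
  cases o <;> simp [Passage.flat]

/-- Smoothing a kink gives back the rest of the diagram, possibly reversed. The reversal negates the
first invariant and preserves the second one. -/
lemma reducible_values {w : List Passage} (hw : IsGauss w) {c : ℕ} (hc : IsReducible w c) :
    c ∈ crossings w ∧
    (∀ κ n, dwrithe n (smooth κ w c) = dwrithe n w ∨
      dwrithe n (smooth κ w c) = -dwrithe n w) ∧
    ∀ κ n m, dwrithe₂ κ n m (smooth κ w c) = dwrithe₂ κ n m w := by
  obtain ⟨o, s, v, h⟩ := hc
  have hf := hw.isFlat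
  have hr : flatten w ~r flatten (⟨c, o, s⟩ :: ⟨c, !o, s⟩ :: v) := h.map _
  have hcw : c ∈ crossings w := mem_crossings.2 ⟨⟨c, o, s⟩, h.mem_iff.2 (by simp), rfl⟩
  rw [flatten_kink] at hr
  set t := if o then -s else s
  have hk := hf.perm hr.perm
  have h1 := (SameCrossing.rotate hf hr (by rwa [flatCrossings_flatten])).2
  have h2 : FlatEq (flatten w) (flatten v) :=
    (FlatEq.of_rotated hf hr).trans (.of_move hk (.r1 c t _))
  have hv := hk.of_move (.r1 c t _)
  rw [flatSmooth_kink hk] at h1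
  refine ⟨hcw, fun κ n => ?_, fun κ n m => ?_⟩
  · rw [dwrithe_smooth κ n hw hcw, dwrithe_eq n hw, flatWrithe_eq n h1, flatWrithe_eq n h2]
    obtain ⟨-, hs, -⟩ := ind_and_smooth κ hw hcw
    split_ifs <;> rcases hs with hs | hs <;> cases κ <;>
      simp [hs, conventionSign, flatWrithe_reverse n hv]
  · rw [dwrithe₂_smooth κ n m hw hcw, dwrithe₂_eq κ n m hw, flatWrithe₂_eq n m h1,
      flatWrithe₂_eq n m h2]
    split_ifs
    · rw [flatWrithe₂_reverse n m hv]
    · rfl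

lemma exists_fresh (w : List Passage) : ∃ a, ∀ p ∈ w, p.crossing ≠ a := by
  obtain ⟨a, ha⟩ := Infinite.exists_notMem_finset (crossings w)
  exact ⟨a, fun p hp h => ha (mem_crossings.2 ⟨p, hp, h⟩)⟩

/-- Adding a kink with the overpass first or with the underpass first realizes both orientations of
the smoothed diagram. -/
lemma exists_kink (κ : Bool) (D : Diagram) (b : Bool) : ∃ D' : Diagram, Equivalent D D' ∧ ∃ c,
    IsReducible D'.word c ∧ ∀ n, dwrithe n (smooth κ D'.word c) =
      if b then dwrithe n D.word else -dwrithe n D.word := by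
  obtain ⟨a, ha⟩ := exists_fresh D.word
  have hg : ∀ o, IsGauss (⟨a, o, 1⟩ :: ⟨a, !o, 1⟩ :: D.word) := by
    intro o
    constructor
    · simp only [List.map_cons, List.nodup_cons, D.nodup, List.mem_cons, List.mem_map, not_or]
      refine ⟨⟨by simp, ?_⟩, ?_, trivial⟩ <;> rintro ⟨p, hp, h⟩ <;>
        exact ha p hp (congrArg Prod.fst h)
    · intro p hp
      simp only [List.mem_cons] at hp ⊢
      rcases hp with rfl | rfl | hp
      · simp
      · simp
      · exact Or.inr (Or.inr (D.paired p hp))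
  -- the overpass has step `-1`
  obtain ⟨o, ho⟩ : ∃ o, o = xor b κ := ⟨_, rfl⟩
  refine ⟨⟨_, (hg o).1, (hg o).2⟩, .symm _ _ (.rel _ _ (.reidemeister1 a o 1 D.word)), a,
    ⟨o, 1, D.word, .refl _⟩, fun n => ?_⟩
  have hc : a ∈ crossings (⟨a, o, 1⟩ :: ⟨a, !o, 1⟩ :: D.word) := by simp [mem_crossings]
  have hs : sgn (⟨a, o, 1⟩ :: ⟨a, !o, 1⟩ :: D.word) a = 1 :=
    (hg o).sgn_eq (p := ⟨a, o, 1⟩) (by simp)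
  have hf := (hg o).isFlat
  rw [flatten_kink] at hf
  rw [dwrithe_smooth κ n (hg o) hc, hs, flatten_kink, flatSmooth_kink hf, dwrithe_eq n D.isGauss]
  have hr := flatWrithe_reverse n D.isGauss.isFlat
  subst ho
  cases b <;> cases κ <;> simp [conventionSign, hr]

lemma mem_reducedValues_dwrithe (κ : Bool) (n : ℤ) (D : Diagram) (g : ℤ) :
    g ∈ reducedValues (fun w c => dwrithe n (smooth κ w c)) D ↔
      g = dwrithe n D.word ∨ g = -dwrithe n D.word := by
  constructor
  · rintro ⟨D', h, c, hc, rfl⟩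
    have := (reducible_values D'.isGauss hc).2.1 κ n
    rwa [dwrithe_eq n D.isGauss, flatWrithe_eq n h.flatEq, ← dwrithe_eq n D'.isGauss]
  · intro h
    rcases h with rfl | rfl
    · obtain ⟨D', h, c, hc, h'⟩ := exists_kink κ D true
      exact ⟨D', h, c, hc, by simpa using h' n⟩
    · obtain ⟨D', h, c, hc, h'⟩ := exists_kink κ D false
      exact ⟨D', h, c, hc, by simpa using h' n⟩

lemma mem_reducedValues_dwrithe₂ (κ : Bool) (m k : ℤ) (D : Diagram) (g : ℤ) :
    g ∈ reducedValues (fun w c => dwrithe₂ κ m k (smooth κ w c)) D ↔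
      g = dwrithe₂ κ m k D.word := by
  have e : ∀ D', Equivalent D D' → dwrithe₂ κ m k D'.word = dwrithe₂ κ m k D.word :=
    fun D' h => by
      rw [dwrithe₂_eq κ m k D.isGauss, dwrithe₂_eq κ m k D'.isGauss, flatWrithe₂_eq m k h.flatEq]
  constructor
  · rintro ⟨D', h, c, hc, rfl⟩
    rw [← e D' h]
    exact (reducible_values D'.isGauss hc).2.2 κ m k
  · rintro rfl
    obtain ⟨D', h, c, hc, -⟩ := exists_kink κ D true
    refine ⟨D', h, c, hc, ?_⟩
    rw [← e D' h]
    exact (reducible_values D'.isGauss hc).2.2 κ m k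

/-! ### The polynomials as sums over all crossings -/

/-- The contribution to `FPoly₃` of a crossing of sign `s` and index `i` whose smoothing has
invariants `g`, `h`, for a diagram with invariants `g₀`, `h₀`. -/
noncomputable def contribution (g₀ h₀ s i g h : ℤ) : ℤ[ℤ × ℤ × ℤ] :=
  single (i, g, h) s - single (0, if (g = g₀ ∨ g = -g₀) ∧ h = h₀ then (g, h) else (g₀, h₀)) s

lemma sum_special {M ι : Type*} [AddCommGroup M] [DecidableEq ι] (S : Finset ι) (q : ι → Prop)
    [DecidablePred q] (f g h : ι → M) :
    ∑ c ∈ S, f c - ∑ c ∈ S with q c, g c - ∑ c ∈ S \ S.filter q, h c =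
      ∑ c ∈ S, (f c - if q c then g c else h c) := by
  rw [← Finset.filter_not, Finset.sum_sub_distrib, Finset.sum_ite, sub_sub]

/-- By the description of the sets `R`, the set `T` consists of the crossings with
`∇J_n(D_c) = ±∇J_n(D)` and `∇J_{m,k}(D_c) = ∇J_{m,k}(D)`. -/
lemma FPoly₃_eq (κ : Bool) (n m k : ℤ) (D : Diagram) :
    FPoly₃ κ n m k D = ∑ c ∈ crossings D.word,
      contribution (dwrithe n D.word) (dwrithe₂ κ m k D.word) (sgn D.word c) (ind D.word c)
        (dwrithe n (smooth κ D.word c)) (dwrithe₂ κ m k (smooth κ D.word c)) := by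
  classical
  rw [FPoly₃, specialCrossings₃]
  simp only [mem_reducedValues_dwrithe, mem_reducedValues_dwrithe₂]
  rw [Finset.filter_congr_decidable, sum_special]
  refine Finset.sum_congr rfl fun c _ => ?_
  rw [contribution]
  split_ifs <;> rfl

/-! ### Invariance -/

/-- The contribution of a crossing, in terms of the flat word and of the sign. -/
noncomputable def flatContribution (κ : Bool) (n m k : ℤ) (w : List Passage) (c : ℕ) :
    ℤ[ℤ × ℤ × ℤ] :=
  contribution (flatWrithe n (flatten w)) (conventionSign κ * flatWrithe₂ m k (flatten w))
    (sgn w c) (sgn w c * flatIndex (flatten w) c)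
    (conventionSign κ * sgn w c * flatWrithe n (flatSmooth (flatten w) c))
    (conventionSign κ * flatWrithe₂ m k (flatSmooth (flatten w) c))

lemma FPoly₃_eq_sum_flat (κ : Bool) (n m k : ℤ) (D : Diagram) :
    FPoly₃ κ n m k D = ∑ c ∈ flatCrossings (flatten D.word), flatContribution κ n m k D.word c := by
  rw [FPoly₃_eq, flatCrossings_flatten]
  refine Finset.sum_congr rfl fun c hc => ?_
  rw [flatContribution, dwrithe_eq n D.isGauss, dwrithe₂_eq κ m k D.isGauss,
    dwrithe_smooth κ n D.isGauss hc, dwrithe₂_smooth κ m k D.isGauss hc,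
    (ind_and_smooth κ D.isGauss hc).1]

lemma flatContribution_congr (κ : Bool) (n m k : ℤ) {w w' : List Passage} {c c' : ℕ}
    (h : FlatEq (flatten w) (flatten w')) (hc : SameCrossing (flatten w) c (flatten w') c')
    (hs : sgn w c = sgn w' c') : flatContribution κ n m k w c = flatContribution κ n m k w' c' := by
  rw [flatContribution, flatContribution, flatWrithe_eq n h, flatWrithe₂_eq m k h, hs, hc.1,
    flatWrithe_eq n hc.2, flatWrithe₂_eq m k hc.2]

lemma contribution_neg (g₀ h₀ s i g h : ℤ) :
    contribution g₀ h₀ (-s) i g h = -contribution g₀ h₀ s i g h := by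
  simp only [contribution, single_neg]; abel

lemma flatContribution_opposite (κ : Bool) (n m k : ℤ) {w : List Passage} {a b : ℕ}
    (hw : IsGauss w) (hb : b ∈ crossings w) (h : OppositeCrossings (flatten w) a b)
    (hs : sgn w a = -sgn w b) :
    flatContribution κ n m k w a + flatContribution κ n m k w b = 0 := by
  have hf := isFlat_flatSmooth hw.isFlat (by rwa [flatCrossings_flatten])
  rw [flatContribution, flatContribution, hs, contribution_neg, h.1, flatWrithe_eq n h.2,
    flatWrithe₂_eq m k h.2, flatWrithe_reverse n hf, flatWrithe₂_reverse m k hf]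
  simp

/-- A kink has index zero and belongs to the set `T`, so its two terms cancel. -/
lemma flatContribution_kink (κ : Bool) (n m k : ℤ) {w : List Passage} (hw : IsGauss w) {c : ℕ}
    (hc : IsReducible w c) (hi : flatIndex (flatten w) c = 0) :
    flatContribution κ n m k w c = 0 := by
  obtain ⟨hcw, h1, h2⟩ := reducible_values hw hc
  rw [flatContribution, ← dwrithe_smooth κ n hw hcw, ← dwrithe₂_smooth κ m k hw hcw,
    ← dwrithe_eq n hw, ← dwrithe₂_eq κ m k hw, h2, hi, mul_zero, contribution,
    if_pos ⟨h1 κ n, rfl⟩, sub_self]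

lemma sgn_congr {w w' : List Passage} (hw : IsGauss w) (hw' : IsGauss w') {v : List Passage}
    (h : ∀ p ∈ v, p ∈ w) (h' : ∀ p ∈ v, p ∈ w') {c : ℕ} (hc : c ∈ flatCrossings (flatten v)) :
    sgn w c = sgn w' c := by
  rw [flatCrossings_flatten] at hc
  obtain ⟨p, hp, rfl⟩ := mem_crossings.1 hc
  rw [hw.sgn_eq (h p hp), hw'.sgn_eq (h' p hp)]

lemma inOrder_mem {ε ε' : ℤˣ} {p q r : Passage} (h : r ∈ inOrder ε p q) : r ∈ inOrder ε' p q := by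
  unfold inOrder at *; split_ifs at * <;> simp_all [or_comm]

lemma sum_flatContribution_bigon (κ : Bool) (n m k : ℤ) {w w' : List Passage} (hw : IsGauss w)
    (hw' : IsGauss w') (he : FlatEq (flatten w) (flatten w')) {a b : ℕ} {P Q x y : FlatWord}
    (hb : IsBigon a b P Q) (e : flatten w = P ++ (x ++ (Q ++ y))) (e' : flatten w' = x ++ y)
    (hm : ∀ p ∈ w', p ∈ w) (hs : sgn w a = -sgn w b) :
    ∑ c ∈ flatCrossings (flatten w), flatContribution κ n m k w c =
      ∑ c ∈ flatCrossings (flatten w'), flatContribution κ n m k w' c := by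
  have hf := hw.isFlat
  rw [e] at hf
  have hbm : b ∈ crossings w := by
    rw [← flatCrossings_flatten, e, flatCrossings_append, hb.flatCrossings_left]
    simp [-mem_flatCrossings]
  have h0 := flatContribution_opposite κ n m k hw hbm (by rw [e]; exact bigon_crossings hb hf) hs
  rw [e, e']
  refine sum_bigon hb hf h0 fun c hc => flatContribution_congr κ n m k he ?_ ?_
  · rw [e, e']; exact sameCrossing_bigon hb hf hc
  · exact sgn_congr (v := w') hw hw' hm (fun p hp => hp) (by rwa [e'])

lemma sum_flatContribution_triangle (κ : Bool) (n m k : ℤ) {w w' : List Passage} (hw : IsGauss w)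
    (hw' : IsGauss w') (he : FlatEq (flatten w) (flatten w')) {a b c : ℕ}
    {P Q R x y z : FlatWord} (ht : IsTriangle a b c P Q R)
    (e : flatten w = P ++ (x ++ (Q ++ (y ++ (R ++ z)))))
    (e' : flatten w' = P.reverse ++ (x ++ (Q.reverse ++ (y ++ (R.reverse ++ z)))))
    (hm : ∀ p ∈ w, p ∈ w') :
    ∑ c ∈ flatCrossings (flatten w), flatContribution κ n m k w c =
      ∑ c ∈ flatCrossings (flatten w'), flatContribution κ n m k w' c := by
  have hf := hw.isFlat
  rw [e', flatCrossings_triangle, ← e]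
  refine Finset.sum_congr rfl fun d hd => flatContribution_congr κ n m k he ?_ ?_
  · rw [e] at hf hd
    rw [e, e']; exact sameCrossing_of_triangle ht hf hd
  · exact sgn_congr hw hw' (fun p hp => hp) hm hd

lemma sum_flatContribution_eq (κ : Bool) (n m k : ℤ) {w w' : List Passage} (mv : Move w w')
    (hw : IsGauss w) (hw' : IsGauss w') :
    ∑ c ∈ flatCrossings (flatten w), flatContribution κ n m k w c =
      ∑ c ∈ flatCrossings (flatten w'), flatContribution κ n m k w' c := by
  have hf := hw.isFlat
  have hm := mv.flat
  have he := FlatEq.of_move hf hm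
  cases mv with
  | rotate _ _ h =>
    have hr : flatten w ~r flatten w' := h.map _
    rw [← flatCrossings_perm hr.perm]
    refine Finset.sum_congr rfl fun c hc => flatContribution_congr κ n m k he (.rotate hf hr hc) ?_
    exact sgn_congr hw hw' (fun _ hp => hp) (fun p hp => h.mem_iff.1 hp) hc
  | relabel f hinj w =>
    have e : flatten (w.map fun p => ⟨f p.crossing, p.isOver, p.sign⟩) =
        (flatten w).map fun p => (f p.1, p.2) := by
      simp [flatten, Function.comp_def, Passage.flat]
    have e' : flatCrossings (flatten (w.map fun p => ⟨f p.crossing, p.isOver, p.sign⟩)) =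
        (flatCrossings (flatten w)).image f := by
      rw [e]; ext c; simp [flatCrossings]
    rw [e', Finset.sum_image hinj.injOn]
    refine Finset.sum_congr rfl fun c hc => flatContribution_congr κ n m k he ?_ ?_
    · rw [e]; exact .relabel hf hinj hc
    · rw [flatCrossings_flatten] at hc
      obtain ⟨p, hp, rfl⟩ := mem_crossings.1 hc
      rw [hw.sgn_eq hp]
      exact (hw'.sgn_eq (p := ⟨f p.crossing, p.isOver, p.sign⟩) (List.mem_map.2 ⟨p, hp, rfl⟩)).symm
  | reidemeister1 a o s w =>
    have e := flatten_kink a o s w'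
    have hf' := hf
    rw [e] at hf'
    have h0 : flatContribution κ n m k (⟨a, o, s⟩ :: ⟨a, !o, s⟩ :: w') a = 0 := by
      refine flatContribution_kink κ n m k hw ⟨o, s, w', .refl _⟩ ?_
      rw [e]; exact flatIndex_kink hf'
    rw [e]
    refine sum_kink hf' h0 fun c hc => flatContribution_congr κ n m k he ?_ ?_
    · rw [e]; exact sameCrossing_kink hf' hc
    · exact sgn_congr (v := w') hw hw' (fun p hp => by simp [hp]) (fun p hp => hp) hc
  | reidemeister2_direct a b s x y =>
    refine sum_flatContribution_bigon (a := a) (b := b) (P := [(a, -s), (b, s)]) (Q := [(a, s), (b, -s)])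
      (x := flatten x) (y := flatten y) κ n m k hw hw' he ⟨-s, by simp, by simp⟩
      (by simp [Passage.flat]) (by simp) (fun p hp => ?_) ?_
    · simp only [List.mem_append] at hp ⊢; tauto
    · rw [hw.sgn_eq (p := ⟨a, true, s⟩) (by simp), hw.sgn_eq (p := ⟨b, true, -s⟩) (by simp)]
      simp
  | reidemeister2_reverse a b s x y =>
    refine sum_flatContribution_bigon (a := a) (b := b) (P := [(a, -s), (b, s)]) (Q := [(b, -s), (a, s)])
      (x := flatten x) (y := flatten y) κ n m k hw hw' he ⟨-s, by simp, by simp⟩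
      (by simp [Passage.flat]) (by simp) (fun p hp => ?_) ?_
    · simp only [List.mem_append] at hp ⊢; tauto
    · rw [hw.sgn_eq (p := ⟨a, true, s⟩) (by simp), hw.sgn_eq (p := ⟨b, true, -s⟩) (by simp)]
      simp
  | reidemeister3_tmb a b c sa sb sc ε x y z =>
    refine sum_flatContribution_triangle (x := flatten x) (y := flatten y) (z := flatten z) κ n m k
      hw hw' he (isTriangle_flatten a b c sa sb sc ε) (by simp)
      (by simp only [flatten_append, flatten_inOrder_neg, List.append_assoc]) ?_
    intro p hp
    simp only [List.mem_append] at hp ⊢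
    rcases hp with (((((hp | hp) | hp) | hp) | hp) | hp) <;>
      first | simp only [hp, or_true, true_or] | simp only [inOrder_mem hp, or_true, true_or]
  | reidemeister3_tbm a b c sa sb sc ε x y z =>
    refine sum_flatContribution_triangle (x := flatten x) (y := flatten y) (z := flatten z) κ n m k
      hw hw' he (isTriangle_flatten a b c sa sb sc ε).swap (by simp)
      (by simp only [flatten_append, flatten_inOrder_neg, List.append_assoc]) ?_
    intro p hp
    simp only [List.mem_append] at hp ⊢
    rcases hp with (((((hp | hp) | hp) | hp) | hp) | hp) <;>
      first | simp only [hp, or_true, true_or] | simp only [inOrder_mem hp, or_true, true_or]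

theorem FPoly₃_invariant (κ : Bool) (n m k : ℤ) {D D' : Diagram} (h : Equivalent D D') :
    FPoly₃ κ n m k D = FPoly₃ κ n m k D' := by
  induction h with
  | rel D D' h =>
    rw [FPoly₃_eq_sum_flat, FPoly₃_eq_sum_flat]
    exact sum_flatContribution_eq κ n m k h D.isGauss D'.isGauss
  | refl => rfl
  | symm _ _ _ ih => exact ih.symm
  | trans _ _ _ _ _ ih ih' => exact ih.trans ih'

/-! ### Large values of the last parameter -/

open Filter in
lemma eventually_dwrithe₂_eq_zero (κ : Bool) (w : List Passage) :
    ∀ᶠ k : ℤ in atTop, ∀ m, dwrithe₂ κ m k w = 0 := by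
  have h : ∀ᶠ k : ℤ in atTop, ∀ c ∈ crossings w, |ind w c| < k :=
    (eventually_all_finset _).2 fun c _ => eventually_gt_atTop _
  filter_upwards [h] with k hk m
  rw [dwrithe₂, Finset.filter_false_of_mem, Finset.filter_false_of_mem]
  · simp
  · intro c hc e
    have := hk c hc
    rw [e, abs_neg] at this
    exact absurd (le_abs_self k) (not_le.2 this)
  · intro c hc e
    have := hk c hc
    rw [e] at this
    exact absurd (le_abs_self k) (not_le.2 this)

lemma FPoly_eq (κ : Bool) (n : ℤ) (D : Diagram) :
    FPoly κ n D = ∑ c ∈ crossings D.word,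
      (single (ind D.word c, dwrithe n (smooth κ D.word c)) (sgn D.word c) -
        single (0, if dwrithe n (smooth κ D.word c) = dwrithe n D.word ∨
            dwrithe n (smooth κ D.word c) = -dwrithe n D.word
          then dwrithe n (smooth κ D.word c) else dwrithe n D.word) (sgn D.word c)) := by
  classical
  rw [FPoly, specialCrossings, Finset.filter_congr_decidable, sum_special]
  refine Finset.sum_congr rfl fun c _ => ?_
  split_ifs <;> rfl

lemma inTwoOfThree_injective : Function.Injective inTwoOfThree := by
  refine mapDomain_injective fun e e' h => ?_
  simp only [Prod.mk.injEq, and_true] at h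
  exact Prod.ext h.1 h.2

/-- `inTwoOfThree` as an additive homomorphism. -/
noncomputable def inTwoOfThreeHom : ℤ[ℤ × ℤ] →+ ℤ[ℤ × ℤ × ℤ] where
  toFun := inTwoOfThree
  map_zero' := mapDomain_zero _
  map_add' := mapDomain_add _

lemma inTwoOfThree_FPoly (κ : Bool) (n m k : ℤ) (D : Diagram)
    (h : dwrithe₂ κ m k D.word = 0)
    (h' : ∀ c ∈ crossings D.word, dwrithe₂ κ m k (smooth κ D.word c) = 0) :
    FPoly₃ κ n m k D = inTwoOfThree (FPoly κ n D) := by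
  rw [FPoly₃_eq, FPoly_eq]
  change _ = inTwoOfThreeHom _
  rw [map_sum]
  refine Finset.sum_congr rfl fun c hc => ?_
  rw [map_sub, h, h' c hc, contribution]
  change _ = mapDomain _ _ - mapDomain _ _
  rw [mapDomain_single, mapDomain_single]
  split_ifs with h1 h2 h2
  · rfl
  · exact absurd h1.1 h2
  · exact absurd ⟨h2, rfl⟩ h1
  · rfl

theorem exists_FPoly₃_eq_inTwoOfThree (κ : Bool) (D : Diagram) : ∃ k₀ : ℤ, ∀ n m k : ℤ, k₀ ≤ k →
    FPoly₃ κ n m k D = inTwoOfThree (FPoly κ n D) := by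
  obtain ⟨k₀, h⟩ := Filter.eventually_atTop.1 ((eventually_dwrithe₂_eq_zero κ D.word).and
    ((Filter.eventually_all_finset (crossings D.word)).2 fun c _ =>
      eventually_dwrithe₂_eq_zero κ (smooth κ D.word c)))
  exact ⟨k₀, fun n m k hk => inTwoOfThree_FPoly κ n m k D ((h k hk).1 m)
    fun c hc => (h k hk).2 c hc m⟩

theorem FPoly_eq_of_FPoly₃_eq (κ : Bool) (D D' : Diagram)
    (h : ∀ n m k, FPoly₃ κ n m k D = FPoly₃ κ n m k D') (n : ℤ) : FPoly κ n D = FPoly κ n D' := by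
  obtain ⟨k, hk⟩ := exists_FPoly₃_eq_inTwoOfThree κ D
  obtain ⟨k', hk'⟩ := exists_FPoly₃_eq_inTwoOfThree κ D'
  apply inTwoOfThree_injective
  rw [← hk n 0 (max k k') (le_max_left _ _), ← hk' n 0 (max k k') (le_max_right _ _)]
  exact h n 0 _

/-! ### Examples -/

/-- The indices of the crossings times their signs. The number of times that `n` occurs minus the
number of times that `-n` occurs is `∇J_n`. -/
def signedIndices (w : List Passage) : Multiset ℤ :=
  (crossings w).val.map fun c => sgn w c * ind w c

lemma dwrithe_eq_sum_signedIndices (n : ℤ) {w : List Passage} (hw : IsGauss w) :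
    dwrithe n w = ((signedIndices w).map (oddDelta n)).sum := by
  rw [dwrithe, writhe, writhe, sum_filter_sub, signedIndices, Multiset.map_map]
  refine Finset.sum_congr rfl fun c hc => ?_
  rcases (ind_and_smooth true hw hc).2.1 with h | h <;> simp [h]

/-- The difference writhes for all `n` at once agree if the signed indices do up to cancellation of
opposite values. -/
lemma dwrithe_eq_dwrithe {w w' : List Passage} (hw : IsGauss w) (hw' : IsGauss w')
    (h : signedIndices w + (signedIndices w').map (-·) =
      signedIndices w' + (signedIndices w).map (-·)) (n : ℤ) : dwrithe n w = dwrithe n w' := by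
  have := congrArg (fun s => (Multiset.map (oddDelta n) s).sum) h
  simp only [Multiset.map_add, Multiset.sum_add, Multiset.map_map, Function.comp_apply,
    oddDelta_neg, Multiset.sum_map_neg] at this
  rw [dwrithe_eq_sum_signedIndices n hw, dwrithe_eq_sum_signedIndices n hw']
  linarith

lemma dwrithe_eq_zero {w : List Passage} (hw : IsGauss w)
    (h : signedIndices w = (signedIndices w).map (-·)) (n : ℤ) : dwrithe n w = 0 := by
  have := congrArg (fun s => (Multiset.map (oddDelta n) s).sum) h
  simp only [Multiset.map_map, Function.comp_apply, oddDelta_neg, Multiset.sum_map_neg] at this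
  rw [dwrithe_eq_sum_signedIndices n hw]
  linarith

/-- A diagram with five crossings, for each of the two conventions: exchanging over and under at every
passage, with the signs kept, compensates for the change of the convention. -/
def fiveCrossingDiagram (κ : Bool) : Diagram where
  word := [⟨0, κ, -1⟩, ⟨1, κ, 1⟩, ⟨0, !κ, -1⟩, ⟨2, !κ, 1⟩, ⟨3, κ, -1⟩, ⟨4, !κ, -1⟩, ⟨1, !κ, 1⟩,
    ⟨2, κ, 1⟩, ⟨4, κ, -1⟩, ⟨3, !κ, -1⟩]
  nodup := by cases κ <;> decide
  paired := by cases κ <;> simp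

/-- A diagram with six crossings that serves for both conventions, as these exchange the exponents
`4` and `-4` of `ℓ₂`. -/
def sixCrossingDiagram : Diagram where
  word := [⟨0, false, -1⟩, ⟨1, false, 1⟩, ⟨2, true, 1⟩, ⟨0, true, -1⟩, ⟨3, true, 1⟩, ⟨1, true, 1⟩,
    ⟨4, true, -1⟩, ⟨3, false, 1⟩, ⟨5, false, -1⟩, ⟨2, false, 1⟩, ⟨4, false, -1⟩, ⟨5, true, -1⟩]
  nodup := by decide
  paired := by simp

lemma crossings_five (κ : Bool) : crossings (fiveCrossingDiagram κ).word = {0, 1, 2, 3, 4} := by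
  cases κ <;> decide +kernel

lemma values_five (κ : Bool) : ∀ c ∈ ({0, 1, 2, 3, 4} : Finset ℕ),
    (sgn (fiveCrossingDiagram κ).word c, ind (fiveCrossingDiagram κ).word c,
      dwrithe₂ κ 1 1 (smooth κ (fiveCrossingDiagram κ).word c)) =
    ([(-1, 1, 0), (1, 0, 0), (1, 1, 0), (-1, 0, -4), (-1, 0, -4)] : List (ℤ × ℤ × ℤ)).getD c 0 := by
  cases κ <;> decide +kernel

lemma dwrithe₂_five (κ : Bool) : dwrithe₂ κ 1 1 (fiveCrossingDiagram κ).word = 0 := by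
  cases κ <;> decide +kernel

lemma dwrithe_five (κ : Bool) (n : ℤ) : dwrithe n (fiveCrossingDiagram κ).word = 0 := by
  refine dwrithe_eq_zero (fiveCrossingDiagram κ).isGauss ?_ n
  cases κ <;> decide +kernel

lemma dwrithe_smooth_five (κ : Bool) (n : ℤ) : ∀ c ∈ crossings (fiveCrossingDiagram κ).word,
    dwrithe n (smooth κ (fiveCrossingDiagram κ).word c) = 0 := by
  have h : ∀ c ∈ crossings (fiveCrossingDiagram κ).word,
      signedIndices (smooth κ (fiveCrossingDiagram κ).word c) =
        (signedIndices (smooth κ (fiveCrossingDiagram κ).word c)).map (-·) := by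
    cases κ <;> decide +kernel
  exact fun c hc => dwrithe_eq_zero (isGauss_smooth κ (fiveCrossingDiagram κ).isGauss hc) (h c hc) n

lemma FPoly_five (κ : Bool) (n : ℤ) : FPoly κ n (fiveCrossingDiagram κ) = 0 := by
  have h0 := values_five κ 0 (by simp)
  have h1 := values_five κ 1 (by simp)
  have h2 := values_five κ 2 (by simp)
  have h3 := values_five κ 3 (by simp)
  have h4 := values_five κ 4 (by simp)
  simp only [List.getD_cons_zero, List.getD_cons_succ, Prod.mk.injEq] at h0 h1 h2 h3 h4
  have hd : ∀ c ∈ ({0, 1, 2, 3, 4} : Finset ℕ),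
      dwrithe n (smooth κ (fiveCrossingDiagram κ).word c) = 0 := by
    rw [← crossings_five κ]; exact dwrithe_smooth_five κ n
  rw [FPoly_eq, crossings_five, dwrithe_five, Finset.sum_congr rfl fun c hc => by rw [hd c hc]]
  simp [h0, h1, h2, h3, h4, single_neg]
  abel

lemma two_eq_single : (2 : ℤ[ℤ × ℤ × ℤ]) = single (0, 0, 0) 1 + single (0, 0, 0) 1 := by
  rw [← one_add_one_eq_two, one_def]; rfl

lemma FPoly₃_five (κ : Bool) :
    FPoly₃ κ 1 1 1 (fiveCrossingDiagram κ) = 2 - single (0, 0, -4) 2 := by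
  have h0 := values_five κ 0 (by simp)
  have h1 := values_five κ 1 (by simp)
  have h2 := values_five κ 2 (by simp)
  have h3 := values_five κ 3 (by simp)
  have h4 := values_five κ 4 (by simp)
  simp only [List.getD_cons_zero, List.getD_cons_succ, Prod.mk.injEq] at h0 h1 h2 h3 h4
  have hd : ∀ c ∈ ({0, 1, 2, 3, 4} : Finset ℕ),
      dwrithe 1 (smooth κ (fiveCrossingDiagram κ).word c) = 0 := by
    rw [← crossings_five κ]; exact dwrithe_smooth_five κ 1
  have h22 : (single (0, 0, -4) 2 : ℤ[ℤ × ℤ × ℤ]) = single (0, 0, -4) 1 + single (0, 0, -4) 1 := by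
    rw [← single_add]; rfl
  rw [FPoly₃_eq, crossings_five, dwrithe_five, dwrithe₂_five,
    Finset.sum_congr rfl fun c hc => by rw [hd c hc], two_eq_single, h22]
  simp [h0, h1, h2, h3, h4, single_neg, contribution]
  abel

lemma crossings_six : crossings sixCrossingDiagram.word = {0, 1, 2, 3, 4, 5} := by
  decide +kernel

lemma values_six : ∀ c ∈ ({0, 1, 2, 3, 4, 5} : Finset ℕ),
    (sgn sixCrossingDiagram.word c, ind sixCrossingDiagram.word c,
      dwrithe₂ true 1 1 (smooth true sixCrossingDiagram.word c),
      dwrithe₂ false 1 1 (smooth false sixCrossingDiagram.word c)) =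
    ([(-1, 0, -4, 4), (1, -1, 0, 0), (1, 0, 0, 0), (1, 0, 0, 0), (-1, -1, 0, 0), (-1, 0, 4, -4)] :
      List (ℤ × ℤ × ℤ × ℤ)).getD c 0 := by
  decide +kernel

lemma dwrithe₂_six (κ : Bool) : dwrithe₂ κ 1 1 sixCrossingDiagram.word = 0 := by
  cases κ <;> decide +kernel

lemma dwrithe_six (n : ℤ) : dwrithe n sixCrossingDiagram.word = 0 :=
  dwrithe_eq_zero sixCrossingDiagram.isGauss (by decide +kernel) n

lemma dwrithe_smooth_six (κ : Bool) (n : ℤ) : ∀ c ∈ ({0, 2, 3, 5} : Finset ℕ),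
    dwrithe n (smooth κ sixCrossingDiagram.word c) = 0 := by
  have h : ∀ c ∈ ({0, 2, 3, 5} : Finset ℕ), c ∈ crossings sixCrossingDiagram.word ∧
      signedIndices (smooth κ sixCrossingDiagram.word c) =
        (signedIndices (smooth κ sixCrossingDiagram.word c)).map (-·) := by
    cases κ <;> decide +kernel
  exact fun c hc =>
    dwrithe_eq_zero (isGauss_smooth κ sixCrossingDiagram.isGauss (h c hc).1) (h c hc).2 n

lemma dwrithe_smooth_six_one_eq_four (κ : Bool) (n : ℤ) :
    dwrithe n (smooth κ sixCrossingDiagram.word 1) =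
      dwrithe n (smooth κ sixCrossingDiagram.word 4) :=
  dwrithe_eq_dwrithe (isGauss_smooth κ sixCrossingDiagram.isGauss (by decide +kernel))
    (isGauss_smooth κ sixCrossingDiagram.isGauss (by decide +kernel))
    (by cases κ <;> decide +kernel) n

lemma FPoly_six (κ : Bool) (n : ℤ) : FPoly κ n sixCrossingDiagram = 0 := by
  have h0 := values_six 0 (by simp)
  have h1 := values_six 1 (by simp)
  have h2 := values_six 2 (by simp)
  have h3 := values_six 3 (by simp)
  have h4 := values_six 4 (by simp)
  have h5 := values_six 5 (by simp)
  simp only [List.getD_cons_zero, List.getD_cons_succ, Prod.mk.injEq] at h0 h1 h2 h3 h4 h5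
  have d0 := dwrithe_smooth_six κ n 0 (by simp)
  have d2 := dwrithe_smooth_six κ n 2 (by simp)
  have d3 := dwrithe_smooth_six κ n 3 (by simp)
  have d5 := dwrithe_smooth_six κ n 5 (by simp)
  rw [FPoly_eq, crossings_six, dwrithe_six]
  simp [h0, h1, h2, h3, h4, h5, d0, d2, d3, d5, dwrithe_smooth_six_one_eq_four, single_neg]

lemma FPoly₃_six (κ : Bool) :
    FPoly₃ κ 1 1 1 sixCrossingDiagram = 2 - single (0, 0, 4) 1 - single (0, 0, -4) 1 := by
  have h0 := values_six 0 (by simp)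
  have h1 := values_six 1 (by simp)
  have h2 := values_six 2 (by simp)
  have h3 := values_six 3 (by simp)
  have h4 := values_six 4 (by simp)
  have h5 := values_six 5 (by simp)
  simp only [List.getD_cons_zero, List.getD_cons_succ, Prod.mk.injEq] at h0 h1 h2 h3 h4 h5
  have d0 := dwrithe_smooth_six κ 1 0 (by simp)
  have d2 := dwrithe_smooth_six κ 1 2 (by simp)
  have d3 := dwrithe_smooth_six κ 1 3 (by simp)
  have d5 := dwrithe_smooth_six κ 1 5 (by simp)
  rw [FPoly₃_eq, crossings_six, dwrithe_six, dwrithe₂_six, two_eq_single]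
  cases κ <;>
    simp [h0, h1, h2, h3, h4, h5, d0, d2, d3, d5, dwrithe_smooth_six_one_eq_four, single_neg,
      contribution] <;>
    abel

end VirtualKnot

theorem theorem4 (κ : Bool) :
    -- (i) invariance
    (∀ (n m k : ℤ) (D D' : VirtualKnot.Diagram), VirtualKnot.Equivalent D D' →
      VirtualKnot.FPoly₃ κ n m k D = VirtualKnot.FPoly₃ κ n m k D') ∧
    -- (ii) for large `k` the new polynomials coincide with the `F`-polynomials
    (∀ D : VirtualKnot.Diagram, ∃ k₀ : ℤ, ∀ n m k : ℤ, k₀ ≤ k →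
      VirtualKnot.FPoly₃ κ n m k D = VirtualKnot.inTwoOfThree (VirtualKnot.FPoly κ n D)) ∧
    -- (ii) hence knots that the new polynomials do not distinguish have the same `F`-polynomials
    (∀ D D' : VirtualKnot.Diagram,
      (∀ n m k : ℤ, VirtualKnot.FPoly₃ κ n m k D = VirtualKnot.FPoly₃ κ n m k D') →
      ∀ n : ℤ, VirtualKnot.FPoly κ n D = VirtualKnot.FPoly κ n D') ∧
    -- (ii) a knot with trivial `F`-polynomials and `F^{1,1,1} = 2 - ℓ₂ ^ 4 - ℓ₂ ^ (-4)`
    (∃ K' : VirtualKnot.Diagram, (∀ n : ℤ, VirtualKnot.FPoly κ n K' = 0) ∧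
      VirtualKnot.FPoly₃ κ 1 1 1 K' =
        2 - AddMonoidAlgebra.single (0, 0, 4) 1 - AddMonoidAlgebra.single (0, 0, -4) 1) ∧
    -- (ii) a knot with five classical crossings, trivial `F`-polynomials and
    -- `F^{1,1,1} = 2 - 2 * ℓ₂ ^ (-4)`
    (∃ (K' : VirtualKnot.Diagram) (α β γ δ₁ δ₂ : ℕ), [α, β, γ, δ₁, δ₂].Nodup ∧
      VirtualKnot.crossings K'.word = {α, β, γ, δ₁, δ₂} ∧
      VirtualKnot.sgn K'.word α = 1 ∧ VirtualKnot.sgn K'.word β = -1 ∧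
      VirtualKnot.sgn K'.word γ = 1 ∧ VirtualKnot.sgn K'.word δ₁ = -1 ∧
      VirtualKnot.sgn K'.word δ₂ = -1 ∧
      VirtualKnot.ind K'.word α = 1 ∧ VirtualKnot.ind K'.word β = 1 ∧
      VirtualKnot.ind K'.word γ = 0 ∧ VirtualKnot.ind K'.word δ₁ = 0 ∧
      VirtualKnot.ind K'.word δ₂ = 0 ∧
      (∀ n : ℤ, VirtualKnot.FPoly κ n K' = 0) ∧
      VirtualKnot.FPoly₃ κ 1 1 1 K' = 2 - AddMonoidAlgebra.single (0, 0, -4) 2) := by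
  refine ⟨fun n m k D D' h => VirtualKnot.FPoly₃_invariant κ n m k h,
    VirtualKnot.exists_FPoly₃_eq_inTwoOfThree κ, VirtualKnot.FPoly_eq_of_FPoly₃_eq κ,
    ⟨VirtualKnot.sixCrossingDiagram, VirtualKnot.FPoly_six κ, VirtualKnot.FPoly₃_six κ⟩,
    VirtualKnot.fiveCrossingDiagram κ, 2, 0, 1, 3, 4, by decide, ?_⟩
  have h0 := VirtualKnot.values_five κ 0 (by simp)
  have h1 := VirtualKnot.values_five κ 1 (by simp)
  have h2 := VirtualKnot.values_five κ 2 (by simp)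
  have h3 := VirtualKnot.values_five κ 3 (by simp)
  have h4 := VirtualKnot.values_five κ 4 (by simp)
  simp only [List.getD_cons_zero, List.getD_cons_succ, Prod.mk.injEq] at h0 h1 h2 h3 h4
  refine ⟨?_, h2.1, h0.1, h1.1, h3.1, h4.1, h2.2.1, h0.2.1, h1.2.1, h3.2.1, h4.2.1,
    VirtualKnot.FPoly_five κ, VirtualKnot.FPoly₃_five κ⟩
  rw [VirtualKnot.crossings_five]; decide
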